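/- For a field $K$ with separable closure $K_s$, let $G(K)=\mathrm{Gal}(K_s/K)$ be its absolute Galois group, a profinite group with the Krull topology. A profinite group $G$ is the free (profinite) product of closed subgroups $G_1,\dots,G_n$ if these generate $G$ topologically and, for every profinite group $H$ and all continuous homomorphisms $\eta_i\colon G_i\to H$ $(i=1,\dots,n)$, there is a unique continuous homomorphism $\eta\colon G\to H$ with $\eta|_{G_i}=\eta_i$ for all $i$. For profinite groups $A_1,\dots,A_n$, write $G\cong A_1*\cdots*A_n$ if $G$ is the free product of closed subgroups $G_1,\dots,G_n$ with $G_i\cong A_i$ as topological groups for all $i$. **Theorem 3.4.** Let $K_1,\dots,K_n$ be arbitrary fields. (a) There is a field $F$ of characteristic $0$ with $G(F)\cong G(K_1)*\cdots*G(K_n)$. (b) Let $p$ be $0$ or a prime number. If all $K_i$ have characteristic $p$, then there is a field $F$ of characteristic $p$ with $G(F)\cong G(K_1)*\cdots*G(K_n)$. -/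

import Mathlib

universe u

/-- The absolute Galois group `G(K) = Gal(K_s / K)` of a field `K`, where `K_s` is the separable
closure of `K`. It carries Mathlib's group structure and Krull topology on `Gal(K_s / K)`, for
which it is a profinite group. -/
abbrev AbsGaloisGroup (K : Type u) [Field K] : Type u :=
  Gal(SeparableClosure K / K)

/-- Let `G` be a profinite group and `S i`, `i ∈ ι`, a family of subgroups (for a finite `ι`).
`IsFreeProfiniteProduct S` says that `G` is the free (profinite) product of the `S i`:
the `S i` are closed, they generate `G` as a topological group, and any family of continuous
homomorphisms from the `S i` to a profinite group `H` extends uniquely to a continuous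
homomorphism from `G` to `H`. (The universe of `H` is immaterial: as `H` is the inverse limit of
finite groups, the condition holds for all profinite `H` as soon as it holds for all finite `H`.) -/
structure IsFreeProfiniteProduct {ι : Type} [Finite ι] {G : Type u} [Group G] [TopologicalSpace G]
    [IsTopologicalGroup G] [CompactSpace G] [TotallyDisconnectedSpace G]
    (S : ι → Subgroup G) : Prop where
  isClosed : ∀ i, IsClosed (S i : Set G)
  generate : (⨆ i, S i).topologicalClosure = ⊤
  existsUnique_extend : ∀ (H : ProfiniteGrp.{u}) (η : ∀ i, S i →ₜ* H),
    ∃! φ : G →ₜ* H, ∀ (i : ι) (g : S i), φ (g : G) = η i g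

/-- The profinite group `G` is isomorphic (as a topological group) to the free profinite product
of the groups `A i`: it is the free product of closed subgroups `S i` with `S i ≅ A i`. -/
def IsIsoFreeProfiniteProduct {ι : Type} [Finite ι] (G : Type u) [Group G] [TopologicalSpace G]
    [IsTopologicalGroup G] [CompactSpace G] [TotallyDisconnectedSpace G]
    (A : ι → Type u) [∀ i, Group (A i)] [∀ i, TopologicalSpace (A i)] : Prop :=
  ∃ S : ι → Subgroup G, IsFreeProfiniteProduct S ∧ ∀ i, Nonempty (A i ≃ₜ* S i)

/-! Write $A_i=G(K_i)$. A finite permutation problem consists of continuous actions of all the $A_i$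
on one finite set. If a profinite group is topologically generated by images of the $A_i$, it is
their free product as soon as every such problem extends to it: finite quotients separate points,
and a homomorphism can be recovered from the closed subgroup generated by its partial graphs
(`isIsoFreeProfiniteProduct_of_forall_permutationProblem`).

One field solves all problems at once. Let $J$ be the disjoint union of the finite sets of all
problems and $L$ the fraction field of the polynomial ring in variables $x_j$, $j\in J$, over
$\mathbb Z$ or $\mathbb F_p$. Suppose each $A_i$ acts with closed stabilizers on an algebraically
closed field $C_i$ and permutes an algebraically independent family $(y_j)$ as $J$ prescribes
(`HasGenericModel`). Then $x_j\mapsto y_j$ embeds $L$, hence its separable closure $N$, in every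
$C_i$. Let $F$ be the set of elements of $N$ whose images are fixed by every $A_i$. The $A_i$ act on
$N$ through $G(F)$, and by Galois theory their images generate it. For a problem $d$ the polynomial
$\prod_k(X-x_{d,k})$ has coefficients in $F$, so $G(F)$ permutes its roots and solves $d$
(`hasGaloisRealization_of_models`).

In the characteristic of $K_i$, a generic model is a field of Hahn series over the algebraic
closure, where equivariant independent families come from primitive elements and Vandermonde
combinations (`hasGenericModel_of_charP`). To pass from a model $k$ of characteristic $p$ to
characteristic $0$, take the valuation ring $O$ of $k((t^{\mathbb Q}))$ and form $W(O)/(p-[t])$, on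
which the group still acts. This is a spherically complete valuation ring with divisible value group
and residue field $k$, so its fraction field is algebraically closed
(`isAlgClosed_of_isSphericallyComplete`, `HasGenericModel.charZero`). -/

/-! ### Spherically complete valuation rings and algebraic closedness -/

/-- A domain is spherically complete for divisibility if every family of closed balls
`p.1 + p.2 A` that are pairwise nested has a common point. -/
def IsSphericallyComplete (A : Type*) [CommRing A] : Prop :=
  ∀ S : Set (A × A), (∀ q ∈ S, q.2 ≠ 0) →
    (∀ q ∈ S, ∀ r ∈ S, q.2 ∣ q.1 - r.1 ∨ r.2 ∣ q.1 - r.1) → ∃ x, ∀ q ∈ S, q.2 ∣ x - q.1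

/-- Every nonzero element is, up to a unit, an `n`-th power, for every `n ≠ 0`. -/
def HasRootsUpToUnits (A : Type*) [CommRing A] : Prop :=
  ∀ a : A, a ≠ 0 → ∀ n : ℕ, n ≠ 0 → ∃ b : A, Associated (b ^ n) a

theorem isUnit_of_surjective_map_ne_zero {A k : Type*} [CommRing A] [IsLocalRing A] [Field k]
    {π : A →+* k} (hπ : Function.Surjective π) {a : A} (ha : π a ≠ 0) : IsUnit a := by
  obtain ⟨b, hb⟩ := hπ (π a)⁻¹
  by_contra hn
  have h1 : π (1 - a * b) = 0 := by
    rw [map_sub, map_one, map_mul, hb, mul_inv_cancel₀ ha, sub_self]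
  have h2 : ¬ IsUnit (1 - a * b) := fun hu => (hu.map π).ne_zero h1
  have h3 : ¬ IsUnit (a * b) := fun hu => hn (isUnit_of_mul_isUnit_left hu)
  have := IsLocalRing.nonunits_add h2 h3
  simp at this

section Extension

open Polynomial

variable {A E Γ : Type*} [CommRing A] [Field E] [Algebra A E]
  [LinearOrderedCommGroupWithZero Γ] (w : Valuation E Γ)

theorem valuation_algebraMap_eq_one (hle : ∀ a : A, w (algebraMap A E a) ≤ 1) {a : A}
    (ha : IsUnit a) : w (algebraMap A E a) = 1 := by
  obtain ⟨b, hb⟩ := ha.exists_right_inv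
  have h : w (algebraMap A E a) * w (algebraMap A E b) = 1 := by
    rw [← map_mul, ← map_mul, hb, map_one, map_one]
  refine le_antisymm (hle a) ?_
  rw [← h]
  exact mul_le_of_le_one_right' (hle b)

theorem valuation_algebraMap_le_of_dvd (hle : ∀ a : A, w (algebraMap A E a) ≤ 1) {a b : A}
    (h : b ∣ a) : w (algebraMap A E a) ≤ w (algebraMap A E b) := by
  obtain ⟨c, rfl⟩ := h
  rw [map_mul, map_mul]
  exact mul_le_of_le_one_right' (hle c)

theorem dvd_of_valuation_algebraMap_le [IsDomain A] [ValuationRing A] [FaithfulSMul A E]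
    (hlt : ∀ a : A, ¬ IsUnit a → w (algebraMap A E a) < 1) {a b : A}
    (h : w (algebraMap A E a) ≤ w (algebraMap A E b)) : b ∣ a := by
  rcases ValuationRing.dvd_total a b with ⟨c, rfl⟩ | h'
  · by_cases hc : IsUnit c
    · obtain ⟨d, hd⟩ := hc.exists_right_inv
      exact ⟨d, by rw [mul_assoc, hd, mul_one]⟩
    · by_cases ha : a = 0
      · simp [ha]
      · exfalso
        have ha' : 0 < w (algebraMap A E a) := by
          rw [zero_lt_iff, Valuation.ne_zero_iff]
          exact (map_ne_zero_iff _ (FaithfulSMul.algebraMap_injective A E)).2 ha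
        rw [map_mul, map_mul] at h
        exact absurd h (not_le.2 (mul_lt_of_lt_one_right ha' (hlt c hc)))
  · exact h'

/-- If `∑ fᵢ = 0`, the maximum of the values is attained twice. -/
theorem exists_ne_valuation_eq_of_sum_eq_zero {ι : Type*} {s : Finset ι} {f : ι → E}
    (hs : s.Nonempty) (hf : ∀ i ∈ s, f i ≠ 0) (h0 : ∑ i ∈ s, f i = 0) :
    ∃ i ∈ s, ∃ j ∈ s, i ≠ j ∧ w (f i) = w (f j) := by
  classical
  obtain ⟨i, hi, hmax⟩ := s.exists_max_image (fun i => w (f i)) hs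
  by_contra! hcon
  have : w (∑ j ∈ s, f j) = w (f i) := by
    apply Valuation.map_sum_eq_of_lt _ hi
    intro j hj
    have hj' := Finset.mem_sdiff.1 hj
    exact lt_of_le_of_ne (hmax j hj'.1)
      (fun h => hcon i hi j hj'.1 (fun e => hj'.2 (by simp [e])) h.symm)
  rw [h0, map_zero] at this
  exact w.ne_zero_iff.2 (hf i hi) this.symm

/-- In an algebraic relation for `α` two terms share the maximal value, so a power of `w α` is a
quotient of values from `A`; roots up to units then give `w α` itself. -/
theorem exists_valuation_eq_algebraMap [IsDomain A] [ValuationRing A] [FaithfulSMul A E]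
    (hdiv : HasRootsUpToUnits A) (hle : ∀ a : A, w (algebraMap A E a) ≤ 1)
    {α : E} (hα : IsAlgebraic A α) (hα0 : α ≠ 0) (hα1 : w α ≤ 1) :
    ∃ b : A, b ≠ 0 ∧ w α = w (algebraMap A E b) := by
  classical
  have inj := FaithfulSMul.algebraMap_injective A E
  obtain ⟨f, hf0, hf⟩ := hα
  have key : ∃ n : ℕ, n ≠ 0 ∧ ∃ r : A, r ≠ 0 ∧ w α ^ n = w (algebraMap A E r) := by
    rw [aeval_eq_sum_range, ← Finset.sum_filter_ne_zero] at hf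
    have hne : (Finset.filter (fun i => f.coeff i • α ^ i ≠ 0)
        (Finset.range (f.natDegree + 1))).Nonempty := by
      refine ⟨f.natDegree, Finset.mem_filter.2 ⟨by simp, ?_⟩⟩
      rw [Algebra.smul_def]
      exact mul_ne_zero ((map_ne_zero_iff _ inj).2 (by simpa using hf0)) (pow_ne_zero _ hα0)
    obtain ⟨i, hi, j, hj, hij, h⟩ := exists_ne_valuation_eq_of_sum_eq_zero w hne
      (fun i hi => (Finset.mem_filter.1 hi).2) hf
    wlog hlt : i < j generalizing i j
    · exact this j hj i hi hij.symm h.symm (lt_of_le_of_ne (not_lt.1 hlt) hij.symm)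
    have hi0 := (Finset.mem_filter.1 hi).2
    have hj0 := (Finset.mem_filter.1 hj).2
    have hci : f.coeff i ≠ 0 := fun e => hi0 (by rw [e, zero_smul])
    have hcj : f.coeff j ≠ 0 := fun e => hj0 (by rw [e, zero_smul])
    obtain ⟨n, rfl⟩ := Nat.exists_eq_add_of_lt hlt
    have hw : w α ≠ 0 := w.ne_zero_iff.2 hα0
    have hwi : w (algebraMap A E (f.coeff i)) ≠ 0 :=
      w.ne_zero_iff.2 ((map_ne_zero_iff _ inj).2 hci)
    have hwj : w (algebraMap A E (f.coeff (i + n + 1))) ≠ 0 :=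
      w.ne_zero_iff.2 ((map_ne_zero_iff _ inj).2 hcj)
    have h' : w (algebraMap A E (f.coeff i)) =
        w (algebraMap A E (f.coeff (i + n + 1))) * w α ^ (n + 1) := by
      rw [Algebra.smul_def, Algebra.smul_def, map_mul, map_mul, map_pow, map_pow,
        add_assoc, pow_add, mul_left_comm, mul_comm (w _) (w α ^ i)] at h
      exact mul_left_cancel₀ (pow_ne_zero i hw) h
    refine ⟨n + 1, by omega, ?_⟩
    rcases ValuationRing.dvd_total (f.coeff (i + n + 1)) (f.coeff i) with ⟨r, hr⟩ | ⟨r, hr⟩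
    · refine ⟨r, fun e => hci (by rw [hr, e, mul_zero]), ?_⟩
      rw [hr, map_mul, map_mul] at h'
      exact (mul_left_cancel₀ hwj h').symm
    · have hr0 : r ≠ 0 := fun e => hcj (by rw [hr, e, mul_zero])
      rw [hr, map_mul, map_mul, mul_assoc] at h'
      have h1 : w (algebraMap A E r) * w α ^ (n + 1) = 1 :=
        mul_left_cancel₀ hwi (by rw [mul_one]; exact h'.symm)
      -- Here the quotient of values is inverse to that of `r`; since neither factor exceeds 1, both
      -- values are 1.
      refine ⟨1, one_ne_zero, ?_⟩
      rw [map_one, map_one]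
      refine le_antisymm (pow_le_one' hα1 _) ?_
      rw [← h1]
      exact mul_le_of_le_one_left' (hle r)
  obtain ⟨n, hn, r, hr0, hr⟩ := key
  obtain ⟨b, u, hb⟩ := hdiv r hr0 n hn
  refine ⟨b, fun e => hr0 (by rw [← hb, e, zero_pow hn, zero_mul]), ?_⟩
  rw [← hb, map_mul, map_mul, valuation_algebraMap_eq_one w hle u.isUnit, mul_one, map_pow,
    map_pow] at hr
  exact (pow_left_inj₀ zero_le zero_le hn).1 hr

/-- Dividing a relation for `β` by its coefficient of largest value makes its reduction nonzero.
That reduction splits over `k`; were every lifted linear factor of value at least 1 at `β`, their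
product would be too, although it agrees with the relation up to value below 1. -/
theorem exists_valuation_sub_algebraMap_lt_one [IsDomain A] [ValuationRing A] [FaithfulSMul A E]
    {k : Type*} [Field k] [IsAlgClosed k] (π : A →+* k) (hπ : Function.Surjective π)
    (hle : ∀ a : A, w (algebraMap A E a) ≤ 1)
    (hlt : ∀ a : A, ¬ IsUnit a → w (algebraMap A E a) < 1)
    {β : E} (hβ : IsAlgebraic A β) (hβ1 : w β = 1) :
    ∃ c : A, w (β - algebraMap A E c) < 1 := by
  have hker : ∀ a : A, π a = 0 → w (algebraMap A E a) < 1 := fun a ha =>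
    hlt a fun hu => (hu.map π).ne_zero ha
  obtain ⟨f, hf0, hf⟩ := hβ
  obtain ⟨g, i, hgi, hg⟩ : ∃ (g : A[X]) (i : ℕ), g.coeff i = 1 ∧ aeval β g = 0 := by
    obtain ⟨i, hi, hmax⟩ := f.support.exists_max_image (fun i => w (algebraMap A E (f.coeff i)))
      (by simpa using hf0)
    have hd : C (f.coeff i) ∣ f := by
      rw [C_dvd_iff_dvd_coeff]
      intro j
      by_cases hj : f.coeff j = 0
      · simp [hj]
      · exact dvd_of_valuation_algebraMap_le w hlt (hmax j (mem_support_iff.2 hj))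
    obtain ⟨g, hg⟩ := hd
    have hi0 : f.coeff i ≠ 0 := mem_support_iff.1 hi
    refine ⟨g, i, ?_, ?_⟩
    · have := congrArg (fun q => coeff q i) hg
      simp only [coeff_C_mul] at this
      exact mul_left_cancel₀ hi0 (by rw [mul_one]; exact this.symm)
    · rw [hg, map_mul, aeval_C, mul_eq_zero] at hf
      exact hf.resolve_left
        ((map_ne_zero_iff _ (FaithfulSMul.algebraMap_injective A E)).2 hi0)
  have hgπ : g.map π ≠ 0 := fun e => by
    have := congrArg (fun q => coeff q i) e
    simp [hgi] at this
  obtain ⟨s, hs⟩ := hπ.hasRightInverse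
  -- A lift of the factored reduction of `g`; its degree may be smaller than that of `g`.
  set h : A[X] := C (s (g.map π).leadingCoeff) *
    (((g.map π).roots.map s).map (fun a => X - C a)).prod with hh
  have hmap : h.map π = g.map π := by
    rw [hh, Polynomial.map_mul, map_C, hs, Polynomial.map_multiset_prod, Multiset.map_map,
      Multiset.map_map]
    conv_rhs => rw [(IsAlgClosed.splits (g.map π)).eq_prod_roots]
    congr 2
    refine Multiset.map_congr rfl fun x _ => ?_
    simp [hs x]
  have hdiff : w (aeval β h) < 1 := by
    have e : aeval β h = - aeval β (g - h) := by simp [hg]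
    rw [e, Valuation.map_neg, aeval_eq_sum_range]
    apply Valuation.map_sum_lt _ one_ne_zero
    intro j _
    rw [Algebra.smul_def, map_mul, map_pow, hβ1, one_pow, mul_one]
    apply hker
    rw [coeff_sub, map_sub, ← coeff_map, ← coeff_map, hmap, sub_self]
  by_contra! hcon
  have hge : 1 ≤ w (aeval β h) := by
    rw [hh, map_mul, map_mul, aeval_C, valuation_algebraMap_eq_one w hle, one_mul,
      map_multiset_prod, map_multiset_prod]
    · simp only [Multiset.map_map]
      refine Multiset.one_le_prod_of_one_le ?_
      intro x hx
      obtain ⟨y, -, rfl⟩ := Multiset.mem_map.1 hx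
      simpa using hcon (s y)
    · apply isUnit_of_surjective_map_ne_zero hπ
      rw [hs]
      exact leadingCoeff_ne_zero.2 hgπ
  exact absurd hdiff (not_lt.2 hge)

/-- Over a spherically complete valuation ring with divisible value group and algebraically closed
residue field, every algebraic element is a fraction. -/
theorem exists_algebraMap_eq_of_isSphericallyComplete [IsDomain A] [ValuationRing A]
    [FaithfulSMul A E]
    {k : Type*} [Field k] [IsAlgClosed k] (π : A →+* k) (hπ : Function.Surjective π)
    (hdiv : HasRootsUpToUnits A) (hsph : IsSphericallyComplete A)
    (hle : ∀ a : A, w (algebraMap A E a) ≤ 1)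
    (hlt : ∀ a : A, ¬ IsUnit a → w (algebraMap A E a) < 1)
    [Algebra.IsAlgebraic A E] {α : E} (hα1 : w α ≤ 1) : ∃ a : A, algebraMap A E a = α := by
  by_contra! hcon
  have halg : ∀ x : E, IsAlgebraic A x := Algebra.IsAlgebraic.isAlgebraic
  have hval : ∀ a : A, ∃ b : A, b ≠ 0 ∧ w (α - algebraMap A E a) = w (algebraMap A E b) :=
    fun a => exists_valuation_eq_algebraMap w hdiv hle (halg _)
      (sub_ne_zero.2 (hcon a).symm) (w.map_sub_le hα1 (hle a))
  -- All balls around points of `A` whose radius is the distance to `α`. They are nested because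
  -- each of them, taken in `E`, contains `α`; a common point is a best approximation of `α` in `A`.
  obtain ⟨x, hx⟩ := hsph {q | q.2 ≠ 0 ∧ w (α - algebraMap A E q.1) = w (algebraMap A E q.2)}
    (fun q hq => hq.1) (by
      rintro q ⟨-, hq⟩ r ⟨-, hr⟩
      have e : algebraMap A E (q.1 - r.1) =
          (α - algebraMap A E r.1) - (α - algebraMap A E q.1) := by
        rw [map_sub]; ring
      have h := w.map_sub (α - algebraMap A E r.1) (α - algebraMap A E q.1)
      rw [← e, hq, hr, le_max_iff] at h
      exact h.symm.imp (dvd_of_valuation_algebraMap_le w hlt)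
        (dvd_of_valuation_algebraMap_le w hlt))
  obtain ⟨b, hb0, hb⟩ := hval x
  have hb0' : algebraMap A E b ≠ 0 :=
    (map_ne_zero_iff _ (FaithfulSMul.algebraMap_injective A E)).2 hb0
  have hwb : w (algebraMap A E b) ≠ 0 := w.ne_zero_iff.2 hb0'
  -- Approximating the normalized error by `c` makes `x + b * c` strictly closer to `α` than `x`, a
  -- contradiction.
  obtain ⟨c, hc⟩ := exists_valuation_sub_algebraMap_lt_one w π hπ hle hlt
    (β := (α - algebraMap A E x) / algebraMap A E b) (halg _)
    (by rw [map_div₀, hb, div_self hwb])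
  obtain ⟨d, hd0, hd⟩ := hval (x + b * c)
  have h1 : w (algebraMap A E d) < w (algebraMap A E b) := by
    have e : α - algebraMap A E (x + b * c) = algebraMap A E b *
        ((α - algebraMap A E x) / algebraMap A E b - algebraMap A E c) := by
      rw [mul_sub, mul_div_cancel₀ _ hb0', map_add, map_mul]; ring
    rw [← hd, e, map_mul]
    exact mul_lt_of_lt_one_right (zero_lt_iff.2 hwb) hc
  have h2 : w (algebraMap A E (x - (x + b * c))) ≤ w (algebraMap A E d) :=
    valuation_algebraMap_le_of_dvd w hle (hx (x + b * c, d) ⟨hd0, hd⟩)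
  have h3 : w (α - algebraMap A E x) ≤ w (algebraMap A E d) := by
    have e : α - algebraMap A E x = (α - algebraMap A E (x + b * c)) -
        algebraMap A E (x - (x + b * c)) := by
      rw [map_sub]; ring
    rw [e]
    exact w.map_sub_le hd.le h2
  rw [hb] at h3
  exact absurd h1 (not_lt.2 h3)

end Extension

/-- The fraction field of a spherically complete valuation ring with divisible value group and
algebraically closed residue field is algebraically closed. -/
theorem isAlgClosed_of_isSphericallyComplete {A k : Type*} {F : Type*} [CommRing A] [IsDomain A]
    [ValuationRing A] [Field k] [IsAlgClosed k] (π : A →+* k) (hπ : Function.Surjective π)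
    (hdiv : HasRootsUpToUnits A) (hsph : IsSphericallyComplete A)
    [Field F] [Algebra A F] [IsFractionRing A F] : IsAlgClosed F := by
  let E := AlgebraicClosure F
  have inj : Function.Injective (algebraMap A E) := by
    rw [IsScalarTower.algebraMap_eq A F E]
    exact (algebraMap F E).injective.comp (IsFractionRing.injective A F)
  have : FaithfulSMul A E := (faithfulSMul_iff_algebraMap_injective A E).2 inj
  have : Algebra.IsAlgebraic A E :=
    (IsFractionRing.comap_isAlgebraic_iff (A := A) (K := F) (C := E)).2 inferInstance
  -- A valuation ring of `E` dominating `A`; domination is what gives nonunits of `A` value below 1.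
  obtain ⟨B, hB⟩ := (LocalSubring.range (algebraMap A E)).exists_le_valuationSubring
  obtain ⟨hAB, hloc⟩ := LocalSubring.le_def.1 hB
  have hmem : ∀ a : A, algebraMap A E a ∈ (LocalSubring.range (algebraMap A E)).toSubring := by
    intro a
    rw [LocalSubring.range_toSubring]
    exact ⟨a, rfl⟩
  have hle : ∀ a : A, B.valuation (algebraMap A E a) ≤ 1 := fun a =>
    (B.valuation_le_one_iff _).2 (hAB (hmem a))
  have hlt : ∀ a : A, ¬ IsUnit a → B.valuation (algebraMap A E a) < 1 := by
    intro a ha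
    refine lt_of_le_of_ne (hle a) fun h => ha ?_
    have h1 : IsUnit (⟨algebraMap A E a, hAB (hmem a)⟩ : B) := (B.valuation_eq_one_iff _).2 h
    have h2 := hloc.map_nonunit ⟨algebraMap A E a, hmem a⟩ h1
    obtain ⟨⟨b, hb⟩, h3⟩ := h2.exists_right_inv
    rw [LocalSubring.range_toSubring] at hb
    obtain ⟨b, rfl⟩ := hb
    have h4 : algebraMap A E a * algebraMap A E b = 1 := congrArg Subtype.val h3
    refine IsUnit.of_mul_eq_one b (inj ?_)
    rw [map_mul, h4, map_one]
  have hsurj : Function.Surjective (algebraMap F E) := by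
    intro α
    by_cases h : B.valuation α ≤ 1
    · obtain ⟨a, ha⟩ := exists_algebraMap_eq_of_isSphericallyComplete B.valuation π hπ hdiv hsph
        hle hlt h
      exact ⟨algebraMap A F a, by rw [← IsScalarTower.algebraMap_apply, ha]⟩
    · have h' : B.valuation α⁻¹ ≤ 1 := by
        rw [map_inv₀]
        exact inv_le_one_of_one_le₀ (not_le.1 h).le
      obtain ⟨a, ha⟩ := exists_algebraMap_eq_of_isSphericallyComplete B.valuation π hπ hdiv hsph
        hle hlt h'
      exact ⟨(algebraMap A F a)⁻¹, by
        rw [map_inv₀, ← IsScalarTower.algebraMap_apply, ha, inv_inv]⟩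
  let e : F ≃+* E := RingEquiv.ofBijective _ ⟨(algebraMap F E).injective, hsurj⟩
  exact IsAlgClosed.of_ringEquiv _ _ e.symm

/-! ### Hahn series fields and their valuation rings -/

namespace HahnSeries

section Integers

variable (Γ k : Type*) [AddCommGroup Γ] [LinearOrder Γ] [IsOrderedAddMonoid Γ] [Field k]

/-- The valuation ring of Hahn series supported on nonnegative exponents. -/
def integers : ValuationSubring (HahnSeries Γ k) where
  carrier := {x | 0 ≤ x.orderTop}
  mul_mem' {x y} hx hy := by
    have hx : 0 ≤ x.orderTop := hx
    have hy : 0 ≤ y.orderTop := hy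
    change 0 ≤ (x * y).orderTop
    rw [orderTop_mul]
    exact add_nonneg hx hy
  one_mem' := by simp
  add_mem' {x y} hx hy := by
    have hx : 0 ≤ x.orderTop := hx
    have hy : 0 ≤ y.orderTop := hy
    exact (le_min hx hy).trans min_orderTop_le_orderTop_add
  zero_mem' := by simp
  neg_mem' {x} hx := by simpa using hx
  mem_or_inv_mem' x := by
    rcases eq_or_ne x 0 with rfl | hx
    · left; simp
    rcases le_total 0 x.orderTop with h | h
    · exact Or.inl h
    · right
      change 0 ≤ x⁻¹.orderTop
      have h1 : x.orderTop + x⁻¹.orderTop = 0 := by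
        rw [← orderTop_mul, mul_inv_cancel₀ hx, orderTop_one]
      by_contra! hlt
      have h2 : x.orderTop + x⁻¹.orderTop < 0 := by
        obtain ⟨a, ha⟩ := WithTop.ne_top_iff_exists.1 (orderTop_ne_top.2 hx)
        obtain ⟨b, hb⟩ := WithTop.ne_top_iff_exists.1 (orderTop_ne_top.2 (inv_ne_zero hx))
        rw [← ha] at h ⊢
        rw [← hb] at hlt ⊢
        norm_cast at h hlt ⊢
        exact add_neg_of_nonpos_of_neg h hlt
      exact absurd h1 h2.ne

variable {Γ k}

theorem mem_integers_iff {x : HahnSeries Γ k} : x ∈ integers Γ k ↔ 0 ≤ x.orderTop := Iff.rfl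

theorem single_mem_integers {γ : Γ} (hγ : 0 ≤ γ) (c : k) : single γ c ∈ integers Γ k :=
  mem_integers_iff.2 ((WithTop.coe_le_coe.2 hγ).trans orderTop_single_le)

theorem dvd_integers_iff {x y : integers Γ k} :
    y ∣ x ↔ y.1.orderTop ≤ x.1.orderTop := by
  constructor
  · rintro ⟨z, rfl⟩
    change _ ≤ (y.1 * z.1).orderTop
    rw [orderTop_mul]
    exact le_add_of_nonneg_right (mem_integers_iff.1 z.2)
  · intro h
    rcases eq_or_ne y 0 with rfl | hy
    · have : x = 0 := by
        ext1
        simpa using h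
      simp [this]
    have hy' : y.1 ≠ 0 := fun e => hy (Subtype.ext e)
    have hz : x.1 / y.1 ∈ integers Γ k := by
      rw [mem_integers_iff]
      have h1 : y.1.orderTop + (x.1 / y.1).orderTop = x.1.orderTop := by
        rw [← orderTop_mul, mul_div_cancel₀ _ hy']
      obtain ⟨b, hb⟩ := WithTop.ne_top_iff_exists.1 (orderTop_ne_top.2 hy')
      rw [← h1, ← hb] at h
      by_contra! hlt
      obtain ⟨a, ha⟩ := WithTop.ne_top_iff_exists.1 (ne_top_of_lt hlt)
      rw [← ha] at h hlt
      norm_cast at h hlt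
      exact absurd h (not_le.2 (add_lt_of_neg_right b hlt))
    exact ⟨⟨x.1 / y.1, hz⟩, Subtype.ext (mul_div_cancel₀ _ hy').symm⟩

variable (Γ k) in
/-- The residue map of the ring of Hahn series with nonnegative exponents. -/
def integersResidue : integers Γ k →+* k where
  toFun x := x.1.coeff 0
  map_one' := by simp
  map_zero' := by simp
  map_add' x y := by simp
  map_mul' x y := by
    change (x.1 * y.1).coeff 0 = _
    rw [coeff_mul, Finset.sum_eq_single (0, 0)]
    · rintro ⟨i, j⟩ hij hne
      exfalso
      rw [Finset.mem_antidiagonal] at hij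
      obtain ⟨hi, hj, hs⟩ := hij
      have hi' : (0 : WithTop Γ) ≤ i :=
        (mem_integers_iff.1 x.2).trans (orderTop_le_of_coeff_ne_zero hi)
      have hj' : (0 : WithTop Γ) ≤ j :=
        (mem_integers_iff.1 y.2).trans (orderTop_le_of_coeff_ne_zero hj)
      norm_cast at hi' hj'
      simp only at hs
      obtain ⟨rfl, rfl⟩ := (add_eq_zero_iff_of_nonneg hi' hj').1 hs
      exact hne rfl
    · intro h
      rw [Finset.mem_antidiagonal] at h
      simp only [mem_support, ne_eq, add_zero, and_true, not_and, not_not] at h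
      by_cases hx : x.1.coeff 0 = 0
      · simp [hx]
      · simp [h hx]

theorem integersResidue_apply (x : integers Γ k) : integersResidue Γ k x = x.1.coeff 0 := rfl

theorem integersResidue_surjective : Function.Surjective (integersResidue Γ k) := fun c =>
  ⟨⟨single 0 c, single_mem_integers le_rfl c⟩, by simp [integersResidue_apply]⟩

/-- The coefficient at `δ` is read off from the centre of any ball of radius beyond `δ`; nestedness
makes the choice irrelevant. -/
theorem isSphericallyComplete_integers : IsSphericallyComplete (integers Γ k) := by
  classical
  intro S hS0 hS
  let f : Γ → k := fun δ =>
    if h : ∃ q ∈ S, (δ : WithTop Γ) < q.2.1.orderTop then h.choose.1.1.coeff δ else 0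
  have hf : ∀ q ∈ S, ∀ δ : Γ, (δ : WithTop Γ) < q.2.1.orderTop → f δ = q.1.1.coeff δ := by
    intro q hq δ hδ
    have h : ∃ q ∈ S, (δ : WithTop Γ) < q.2.1.orderTop := ⟨q, hq, hδ⟩
    have hfd : f δ = h.choose.1.1.coeff δ := dif_pos h
    obtain ⟨hr, hrδ⟩ := h.choose_spec
    have h1 : (δ : WithTop Γ) < (h.choose.1.1 - q.1.1).orderTop := by
      rcases hS _ hr _ hq with h2 | h2
      · exact hrδ.trans_le (dvd_integers_iff.1 h2)
      · exact hδ.trans_le (dvd_integers_iff.1 h2)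
    have h3 := coeff_eq_zero_of_lt_orderTop h1
    rw [coeff_sub, sub_eq_zero] at h3
    rw [hfd, h3]
  have hsupp : ∀ δ, f δ ≠ 0 → ∃ q ∈ S, (δ : WithTop Γ) < q.2.1.orderTop := by
    intro δ hδ
    by_contra hn
    exact hδ (dif_neg hn)
  have hpwo : (Function.support f).IsPWO := by
    refine Set.partiallyWellOrderedOn_iff_exists_lt.2 fun s hs => ?_
    -- If no later term reaches `s 0`, the whole sequence lies below `s 0`, where `f` agrees with a
    -- single Hahn series, whose support is well ordered.
    by_cases h : ∃ n, 0 < n ∧ s 0 ≤ s n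
    · obtain ⟨n, hn, h⟩ := h
      exact ⟨0, n, hn, h⟩
    · push Not at h
      obtain ⟨q, hq, h0⟩ := hsupp _ (hs 0)
      refine q.1.1.isPWO_support.exists_lt (f := s) fun n => ?_
      have hle : s n ≤ s 0 := by
        rcases Nat.eq_zero_or_pos n with rfl | hn
        · exact le_rfl
        · exact (h n hn).le
      rw [mem_support, ← hf q hq (s n) (lt_of_le_of_lt (by exact_mod_cast hle) h0)]
      exact hs n
  let x : HahnSeries Γ k := ⟨f, hpwo⟩
  have hx : x ∈ integers Γ k := by
    rw [mem_integers_iff, le_orderTop_iff_forall]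
    intro δ hδ
    by_contra hne
    obtain ⟨q, hq, h0⟩ := hsupp δ hne
    have h1 : x.coeff δ = q.1.1.coeff δ := hf q hq δ h0
    exact hne (h1.trans (coeff_eq_zero_of_lt_orderTop (hδ.trans_le (mem_integers_iff.1 q.1.2))))
  refine ⟨⟨x, hx⟩, fun q hq => dvd_integers_iff.2 ?_⟩
  rw [le_orderTop_iff_forall]
  intro δ hδ
  change (x - q.1.1).coeff δ = 0
  rw [coeff_sub, sub_eq_zero]
  exact hf q hq δ hδ

theorem hasRootsUpToUnits_integers (hΓ : ∀ (γ : Γ) (n : ℕ), n ≠ 0 → ∃ δ : Γ, n • δ = γ) :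
    HasRootsUpToUnits (integers Γ k) := by
  intro a ha n hn
  have ha' : a.1 ≠ 0 := fun e => ha (Subtype.ext e)
  obtain ⟨δ, hδ⟩ := hΓ a.1.order n hn
  have h0 : 0 ≤ δ := by
    have h1 : 0 ≤ a.1.order := zero_le_orderTop_iff.1 (mem_integers_iff.1 a.2)
    rw [← hδ] at h1
    exact (nsmul_nonneg_iff hn).1 h1
  have key : (single δ (1 : k) ^ n).orderTop = a.1.orderTop := by
    rw [single_pow, hδ, one_pow, orderTop_single one_ne_zero, order_eq_orderTop_of_ne_zero ha']
  exact ⟨⟨single δ 1, single_mem_integers h0 1⟩, associated_of_dvd_dvd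
    (dvd_integers_iff.2 key.le) (dvd_integers_iff.2 key.ge)⟩

/-- The field of Hahn series with divisible exponent group and algebraically closed coefficient
field is algebraically closed. -/
theorem isAlgClosed [IsAlgClosed k] (hΓ : ∀ (γ : Γ) (n : ℕ), n ≠ 0 → ∃ δ : Γ, n • δ = γ) :
    IsAlgClosed (HahnSeries Γ k) :=
  isAlgClosed_of_isSphericallyComplete (integersResidue Γ k) integersResidue_surjective
    (hasRootsUpToUnits_integers hΓ) isSphericallyComplete_integers

theorem charP_integers (p : ℕ) [CharP k p] : CharP (integers Γ k) p :=
  charP_of_injective_ringHom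
    (f := (C.codRestrict (integers Γ k) fun c => single_mem_integers le_rfl c : k →+* integers Γ k))
    (RingHom.injective _) p

theorem perfectRing_integers [IsAlgClosed k]
    (hΓ : ∀ (γ : Γ) (n : ℕ), n ≠ 0 → ∃ δ : Γ, n • δ = γ) (p : ℕ) [Fact p.Prime]
    [CharP (integers Γ k) p] : PerfectRing (integers Γ k) p := by
  have := isAlgClosed (k := k) hΓ
  refine PerfectRing.ofSurjective _ p fun x => ?_
  obtain ⟨z, hz⟩ := IsAlgClosed.exists_pow_nat_eq x.1 (Fact.out : p.Prime).pos
  have hzm : z ∈ integers Γ k := by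
    rw [← (integers Γ k).valuation_le_one_iff]
    have h := ((integers Γ k).valuation_le_one_iff _).2 x.2
    rw [← hz, map_pow] at h
    exact (pow_le_one_iff (Fact.out : p.Prime).ne_zero).1 h
  exact ⟨⟨z, hzm⟩, Subtype.ext hz⟩

end Integers

section Map

variable {Γ k : Type*} [AddCommGroup Γ] [LinearOrder Γ] [IsOrderedAddMonoid Γ]
  [Field k]

/-- The action of ring endomorphisms of the coefficients on Hahn series. -/
def mapEndHom : (k →+* k) →* (HahnSeries Γ k →+* HahnSeries Γ k) where
  toFun f :=
    { toFun x := x.map f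
      map_one' := HahnSeries.map_one f.toMonoidWithZeroHom
      map_zero' := HahnSeries.map_zero (f : ZeroHom k k)
      map_mul' _ _ := HahnSeries.map_mul (f : k →ₙ+* k)
      map_add' _ _ := HahnSeries.map_add (f : k →+ k) }
  map_one' := by ext; rfl
  map_mul' f g := by ext; rfl

@[simp]
theorem mapEndHom_coeff (f : k →+* k) (x : HahnSeries Γ k) (γ : Γ) :
    (mapEndHom f x).coeff γ = f (x.coeff γ) := rfl

theorem mapEndHom_single (f : k →+* k) (γ : Γ) (c : k) :
    mapEndHom f (single γ c) = single γ (f c) :=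
  HahnSeries.map_single (f : ZeroHom k k)

theorem mapEndHom_mem_integers (f : k →+* k) {x : HahnSeries Γ k} (hx : x ∈ integers Γ k) :
    mapEndHom f x ∈ integers Γ k := by
  rw [mem_integers_iff, le_orderTop_iff_forall] at *
  intro j hj
  rw [mapEndHom_coeff, hx j hj, map_zero]

/-- The action of ring endomorphisms of the coefficients on Hahn series with nonnegative
exponents. -/
noncomputable def integersMapEndHom : (k →+* k) →* (integers Γ k →+* integers Γ k) where
  toFun f := ((mapEndHom f).comp (integers Γ k).subtype).codRestrict (integers Γ k)
    fun x => mapEndHom_mem_integers f x.2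
  map_one' := by ext; simp
  map_mul' f g := by ext; simp

end Map

end HahnSeries

/-! ### Untilts: the valuation ring `W(O) / (p - [t])` -/

section Untilt

open WittVector

set_option linter.unusedSectionVars false

variable {p : ℕ} [Fact p.Prime] {O : Type*} [CommRing O]

theorem WittVector.exists_limit [CharP O p] [PerfectRing O p] (w : ℕ → WittVector p O)
    (hw : ∀ n, (p : WittVector p O) ^ n ∣ w (n + 1) - w n) :
    ∃ x, ∀ n, (p : WittVector p O) ^ n ∣ x - w n := by
  have key : ∀ m n, m ≤ n → (p : WittVector p O) ^ m ∣ w n - w m := by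
    intro m n hmn
    induction n, hmn using Nat.le_induction with
    | base => simp
    | succ n hmn ih =>
      have := dvd_add ((pow_dvd_pow _ hmn).trans (hw n)) ih
      simpa using this
  obtain ⟨x, hx⟩ := (isAdicCompleteIdealSpanP (p := p) (k := O)).prec (f := w) (by
    intro m n hmn
    rw [SModEq.sub_mem, smul_eq_mul, Ideal.mul_top, Ideal.span_singleton_pow,
      Ideal.mem_span_singleton]
    rw [← dvd_neg, neg_sub]
    exact key m n hmn)
  refine ⟨x, fun n => ?_⟩
  have := hx n
  rw [SModEq.sub_mem, smul_eq_mul, Ideal.mul_top, Ideal.span_singleton_pow,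
      Ideal.mem_span_singleton] at this
  rw [← dvd_neg, neg_sub]
  exact this

theorem WittVector.eq_zero_of_forall_dvd [CharP O p] [PerfectRing O p] {w : WittVector p O}
    (hw : ∀ n, (p : WittVector p O) ^ n ∣ w) : w = 0 := by
  refine (isAdicCompleteIdealSpanP (p := p) (k := O)).haus w fun n => ?_
  rw [SModEq.sub_mem, smul_eq_mul, Ideal.mul_top, Ideal.span_singleton_pow,
      Ideal.mem_span_singleton, sub_zero]
  exact hw n

theorem WittVector.dvd_iff_coeff_zero [CharP O p] [PerfectRing O p] {w : WittVector p O} :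
    (p : WittVector p O) ∣ w ↔ constantCoeff w = 0 := by
  rw [← Ideal.mem_span_singleton, ← ker_constantCoeff, RingHom.mem_ker]

theorem WittVector.constantCoeff_teichmuller (c : O) :
    constantCoeff (teichmuller p c) = c := teichmuller_coeff_zero p c

theorem WittVector.constantCoeff_p [CharP O p] :
    constantCoeff (p : WittVector p O) = 0 := by
  rw [map_natCast, CharP.cast_eq_zero]

theorem WittVector.isUnit_of_isUnit_constantCoeff [CharP O p] [PerfectRing O p]
    {w : WittVector p O} (hw : IsUnit (constantCoeff w)) : IsUnit w := by
  obtain ⟨d, hd⟩ := hw.exists_right_inv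
  have h1 : (p : WittVector p O) ∣ w * teichmuller p d - 1 := by
    rw [dvd_iff_coeff_zero, map_sub, map_mul, constantCoeff_teichmuller, hd, map_one, sub_self]
  have h2 : (p : WittVector p O) ∈ (⊥ : Ideal (WittVector p O)).jacobson :=
    IsAdicComplete.le_jacobson_bot (Ideal.span {(p : WittVector p O)})
      (Ideal.mem_span_singleton_self _)
  obtain ⟨z, hz⟩ := h1
  have h3 := Ideal.mem_jacobson_bot.1 h2 z
  rw [← hz, sub_add_cancel] at h3
  exact isUnit_of_mul_isUnit_left h3

variable (p) in
/-- The characteristic zero ring `W(O) / (p - [t])` attached to a ring `O` of characteristic `p`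
and an element `t`. -/
abbrev Untilt (t : O) : Type _ :=
  WittVector p O ⧸ Ideal.span {(p : WittVector p O) - teichmuller p t}

namespace Untilt

variable (p) in
/-- The projection of the Witt vectors onto the untilt. -/
noncomputable abbrev mk (t : O) : WittVector p O →+* Untilt p t := Ideal.Quotient.mk _

variable (p) in
/-- The multiplicative lift from `O` to the untilt. -/
noncomputable def lift (t : O) : O →* Untilt p t :=
  (mk p t : WittVector p O →* Untilt p t).comp (teichmuller p)

variable {t : O}

theorem mk_eq_zero_iff {w : WittVector p O} :
    mk p t w = 0 ↔ (p : WittVector p O) - teichmuller p t ∣ w := by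
  rw [Ideal.Quotient.eq_zero_iff_mem, Ideal.mem_span_singleton]

theorem mk_surjective : Function.Surjective (mk p t) := Ideal.Quotient.mk_surjective

theorem lift_apply (c : O) : lift p t c = mk p t (teichmuller p c) := rfl

theorem p_eq_lift : (p : Untilt p t) = lift p t t := by
  rw [lift_apply, ← sub_eq_zero, ← map_natCast (mk p t), ← map_sub, mk_eq_zero_iff]

/-- Modulo `p` the element `p - [t]` becomes `-t`, so the untilt modulo `p` is `O` modulo `t`. -/
theorem dvd_mk_iff [CharP O p] [PerfectRing O p] {w : WittVector p O} :
    (p : Untilt p t) ∣ mk p t w ↔ t ∣ constantCoeff w := by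
  constructor
  · rintro ⟨z, hz⟩
    obtain ⟨z, rfl⟩ := mk_surjective z
    have h : mk p t (w - p * z) = 0 := by rw [map_sub, hz, map_mul, map_natCast, sub_self]
    obtain ⟨y, hy⟩ := mk_eq_zero_iff.1 h
    have h2 := congrArg constantCoeff hy
    rw [map_sub, map_mul, map_mul, map_sub, constantCoeff_p, constantCoeff_teichmuller, zero_mul,
      sub_zero, zero_sub] at h2
    rw [h2]
    exact Dvd.intro _ (by ring : t * (-constantCoeff y) = _)
  · rintro ⟨s, hs⟩
    obtain ⟨z, hz⟩ : (p : WittVector p O) ∣ w - teichmuller p t * teichmuller p s := by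
      rw [dvd_iff_coeff_zero, map_sub, map_mul, constantCoeff_teichmuller,
        constantCoeff_teichmuller, hs, sub_self]
    rw [sub_eq_iff_eq_add] at hz
    rw [hz, map_add, map_mul, map_mul, ← lift_apply, ← p_eq_lift, map_natCast]
    exact dvd_add (dvd_mul_right _ _) (dvd_mul_right _ _)

/-- One step of a `p`-adic expansion; the digit `c` may be any representative modulo `t`. -/
theorem exists_eq_lift_add [CharP O p] [PerfectRing O p] {a : Untilt p t} {w : WittVector p O}
    (hw : mk p t w = a) {c : O} (hc : t ∣ constantCoeff w - c) :
    ∃ b, a = lift p t c + p * b := by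
  have : (p : Untilt p t) ∣ mk p t (w - teichmuller p c) := by
    rw [dvd_mk_iff, map_sub, constantCoeff_teichmuller]
    exact hc
  obtain ⟨b, hb⟩ := this
  rw [map_sub, hw, sub_eq_iff_eq_add] at hb
  exact ⟨b, by rw [hb, lift_apply, add_comm]⟩

theorem exists_limit [CharP O p] [PerfectRing O p] (a : ℕ → Untilt p t)
    (ha : ∀ n, (p : Untilt p t) ^ n ∣ a (n + 1) - a n) :
    ∃ x, ∀ n, (p : Untilt p t) ^ n ∣ x - a n := by
  choose d hd using ha
  choose d' hd' using fun n => mk_surjective (d n)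
  obtain ⟨w0, hw0⟩ := mk_surjective (a 0)
  let w : ℕ → WittVector p O := fun n => w0 + ∑ i ∈ Finset.range n, (p : WittVector p O) ^ i * d' i
  have hw : ∀ n, mk p t (w n) = a n := by
    intro n
    induction n with
    | zero => simp [w, hw0]
    | succ n ih =>
      have e : w (n + 1) = w n + (p : WittVector p O) ^ n * d' n := by
        simp only [w, Finset.sum_range_succ, add_assoc]
      rw [e, map_add, ih, map_mul, map_pow, map_natCast, hd', ← hd, add_sub_cancel]
  obtain ⟨x, hx⟩ := WittVector.exists_limit w fun n =>
    ⟨d' n, by simp only [w, Finset.sum_range_succ]; ring⟩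
  refine ⟨mk p t x, fun n => ?_⟩
  have := map_dvd (mk p t) (hx n)
  rwa [map_pow, map_natCast, map_sub, hw] at this

theorem lift_dvd_p_pow {c : O} {n : ℕ} (h : c ∣ t ^ n) :
    lift p t c ∣ (p : Untilt p t) ^ n := by
  rw [p_eq_lift, ← map_pow]
  exact map_dvd _ h

variable [IsDomain O] [CharP O p] [PerfectRing O p]

/-- Modulo `p` the factor `p - [t]` is `-t`, a nonzero element of a domain, so a factor `p` of the
product comes from `d` and can be cancelled. -/
theorem pow_dvd_of_pow_dvd_mul (ht : t ≠ 0) (n : ℕ) (d : WittVector p O)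
    (h : (p : WittVector p O) ^ n ∣ ((p : WittVector p O) - teichmuller p t) * d) :
    (p : WittVector p O) ^ n ∣ d := by
  induction n generalizing d with
  | zero => simp
  | succ n ih =>
    have h1 := dvd_iff_coeff_zero.1 ((dvd_pow_self _ n.succ_ne_zero).trans h)
    rw [map_mul, map_sub, constantCoeff_p, constantCoeff_teichmuller, zero_sub, neg_mul,
      neg_eq_zero, mul_eq_zero] at h1
    obtain ⟨d', rfl⟩ := dvd_iff_coeff_zero.2 (h1.resolve_left ht)
    rw [pow_succ'] at h ⊢
    rw [mul_left_comm] at h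
    have hp : (p : WittVector p O) ≠ 0 := p_nonzero p O
    exact mul_dvd_mul_left _ (ih d' ((mul_dvd_mul_iff_left hp).1 h))

/-- The ideal generated by `p - [t]` is `p`-adically closed: by `pow_dvd_of_pow_dvd_mul`, the
approximate quotients form a Cauchy sequence. -/
theorem eq_zero_of_forall_dvd (ht : t ≠ 0) {a : Untilt p t}
    (ha : ∀ n, (p : Untilt p t) ^ n ∣ a) : a = 0 := by
  obtain ⟨w, rfl⟩ := mk_surjective a
  have h : ∀ n, ∃ z, (p : WittVector p O) ^ n ∣
      w - ((p : WittVector p O) - teichmuller p t) * z := by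
    intro n
    obtain ⟨y, hy⟩ := ha n
    obtain ⟨y, rfl⟩ := mk_surjective y
    have : mk p t (w - p ^ n * y) = 0 := by
      rw [map_sub, hy, map_mul, map_pow, map_natCast, sub_self]
    obtain ⟨z, hz⟩ := mk_eq_zero_iff.1 this
    exact ⟨z, y, by rw [← hz]; ring⟩
  choose z hz using h
  obtain ⟨x, hx⟩ := WittVector.exists_limit z fun n => pow_dvd_of_pow_dvd_mul ht n _ (by
    have := dvd_sub (hz n) ((pow_dvd_pow _ n.le_succ).trans (hz (n + 1)))
    rwa [sub_sub_sub_cancel_left, ← mul_sub] at this)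
  rw [mk_eq_zero_iff]
  refine ⟨x, sub_eq_zero.1 (WittVector.eq_zero_of_forall_dvd fun n => ?_)⟩
  have := dvd_sub (hz n) ((hx n).mul_left ((p : WittVector p O) - teichmuller p t))
  convert this using 1
  ring

theorem p_pow_ne_zero (ht : t ≠ 0) (htu : ¬ IsUnit t) (n : ℕ) : (p : Untilt p t) ^ n ≠ 0 := by
  intro h
  rw [← map_natCast (mk p t), ← map_pow, mk_eq_zero_iff] at h
  obtain ⟨y, hy⟩ := h
  obtain ⟨z, rfl⟩ := pow_dvd_of_pow_dvd_mul ht n y ⟨1, by rw [← hy, mul_one]⟩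
  have hp : (p : WittVector p O) ^ n ≠ 0 := pow_ne_zero _ (p_nonzero p O)
  rw [mul_left_comm] at hy
  have h1 : ((p : WittVector p O) - teichmuller p t) * z = 1 :=
    mul_left_cancel₀ hp (by rw [← hy, mul_one])
  have h2 := congrArg constantCoeff h1
  rw [map_mul, map_sub, constantCoeff_p, constantCoeff_teichmuller, map_one, zero_sub] at h2
  exact htu (IsUnit.of_mul_eq_one (-constantCoeff z) (by rw [← h2]; ring))

theorem lift_ne_zero (ht : t ≠ 0) (htu : ¬ IsUnit t) (hrank : ∀ c : O, c ≠ 0 → ∃ n, c ∣ t ^ n)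
    {c : O} (hc : c ≠ 0) : lift p t c ≠ 0 := by
  intro h
  obtain ⟨n, hn⟩ := hrank c hc
  have := lift_dvd_p_pow (p := p) hn
  rw [h, zero_dvd_iff] at this
  exact p_pow_ne_zero ht htu n this

variable [ValuationRing O]

/-- After removing the largest power of `p = [t]`, the constant coefficient `c` satisfies `t = c *
s` with `s` a nonunit. Then `[c] + p z = [c] (1 + [s] z)` in the untilt, and the last factor is a
unit. Thus divisibility in the untilt is governed by divisibility in `O`. -/
theorem exists_associated_lift (ht : t ≠ 0) {a : Untilt p t} (ha : a ≠ 0) :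
    ∃ c : O, c ≠ 0 ∧ Associated (lift p t c) a := by
  classical
  have hex : ∃ n, ¬ (p : Untilt p t) ^ n ∣ a := by
    by_contra! h
    exact ha (eq_zero_of_forall_dvd ht h)
  have hn := Nat.find_spec hex
  obtain ⟨n, hn'⟩ : ∃ n, Nat.find hex = n + 1 := by
    refine Nat.exists_eq_succ_of_ne_zero fun h => hn ?_
    rw [h, pow_zero]
    exact one_dvd _
  rw [hn'] at hn
  have hmin : (p : Untilt p t) ^ n ∣ a := by
    by_contra h
    have := Nat.find_min' hex h
    omega
  obtain ⟨b, rfl⟩ := hmin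
  obtain ⟨w, rfl⟩ := mk_surjective b
  have hw : ¬ t ∣ constantCoeff w := by
    intro h
    rw [pow_succ] at hn
    exact hn (mul_dvd_mul_left _ (dvd_mk_iff.2 h))
  set c := constantCoeff w with hc
  obtain ⟨s, hs⟩ := (ValuationRing.dvd_total t c).resolve_left hw
  have hsu : ¬ IsUnit s := fun hu => hw (by
    obtain ⟨r, hr⟩ := hu.exists_right_inv
    exact ⟨r, by rw [hs, mul_assoc, hr, mul_one]⟩)
  have hc0 : c ≠ 0 := fun h => hw (by rw [h]; exact dvd_zero _)
  obtain ⟨z, hz⟩ : (p : WittVector p O) ∣ w - teichmuller p c := by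
    rw [dvd_iff_coeff_zero, map_sub, constantCoeff_teichmuller, hc, sub_self]
  have hunit : IsUnit (1 + teichmuller p s * z) := by
    apply isUnit_of_isUnit_constantCoeff
    rw [map_add, map_one, map_mul, constantCoeff_teichmuller]
    by_contra hnu
    have h2 : ¬ IsUnit (-(s * constantCoeff z)) := fun h =>
      hsu (isUnit_of_mul_isUnit_left ((IsUnit.neg_iff _).1 h))
    have := IsLocalRing.nonunits_add hnu h2
    simp at this
  refine ⟨t ^ n * c, mul_ne_zero (pow_ne_zero _ ht) hc0, ?_⟩
  have e : mk p t w = lift p t c * mk p t (1 + teichmuller p s * z) := by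
    rw [sub_eq_iff_eq_add] at hz
    rw [hz, map_add, map_mul, map_natCast, p_eq_lift, map_add, map_one, map_mul, ← lift_apply,
      ← lift_apply, mul_add, mul_one, ← mul_assoc, ← map_mul, ← hs, add_comm]
  rw [e, map_mul, map_pow, ← p_eq_lift, ← mul_assoc]
  obtain ⟨u, hu⟩ := hunit.map (mk p t)
  exact ⟨u, by rw [hu]⟩

theorem isDomain (ht : t ≠ 0) (htu : ¬ IsUnit t) (hrank : ∀ c : O, c ≠ 0 → ∃ n, c ∣ t ^ n) :
    IsDomain (Untilt p t) := by
  have : Nontrivial (Untilt p t) := ⟨⟨(p : Untilt p t) ^ 1, 0, p_pow_ne_zero ht htu 1⟩⟩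
  have : NoZeroDivisors (Untilt p t) := by
    refine ⟨fun {a b} hab => ?_⟩
    by_contra! hne
    obtain ⟨c, hc, hca⟩ := exists_associated_lift ht hne.1
    obtain ⟨d, hd, hdb⟩ := exists_associated_lift ht hne.2
    have h := hca.mul_mul hdb
    rw [hab, associated_zero_iff_eq_zero, ← map_mul] at h
    exact lift_ne_zero ht htu hrank (mul_ne_zero hc hd) h
  exact NoZeroDivisors.to_isDomain _

theorem valuationRing (ht : t ≠ 0) [IsDomain (Untilt p t)] : ValuationRing (Untilt p t) := by
  rw [ValuationRing.iff_dvd_total]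
  refine ⟨fun a b => ?_⟩
  rcases eq_or_ne a 0 with rfl | ha
  · exact Or.inr (dvd_zero _)
  rcases eq_or_ne b 0 with rfl | hb
  · exact Or.inl (dvd_zero _)
  obtain ⟨c, hc, hca⟩ := exists_associated_lift ht ha
  obtain ⟨d, hd, hdb⟩ := exists_associated_lift ht hb
  rcases ValuationRing.dvd_total c d with h | h
  · exact Or.inl (hca.symm.dvd.trans ((map_dvd _ h).trans hdb.dvd))
  · exact Or.inr (hdb.symm.dvd.trans ((map_dvd _ h).trans hca.dvd))

theorem hasRootsUpToUnits (ht : t ≠ 0) (hO : HasRootsUpToUnits O) :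
    HasRootsUpToUnits (Untilt p t) := by
  intro a ha n hn
  obtain ⟨c, hc, hca⟩ := exists_associated_lift ht ha
  obtain ⟨b, hb⟩ := hO c hc n hn
  refine ⟨lift p t b, Associated.trans ?_ hca⟩
  rw [← map_pow]
  exact hb.map _

theorem dvd_p_pow (ht : t ≠ 0) (hrank : ∀ c : O, c ≠ 0 → ∃ n, c ∣ t ^ n)
    {a : Untilt p t} (ha : a ≠ 0) : ∃ n, a ∣ (p : Untilt p t) ^ n := by
  obtain ⟨c, hc, hca⟩ := exists_associated_lift ht ha
  obtain ⟨n, hn⟩ := hrank c hc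
  exact ⟨n, hca.symm.dvd.trans (lift_dvd_p_pow hn)⟩

theorem dvd_constantCoeff_of_lift_dvd {c : O} (hc : c ∣ t) {w : WittVector p O}
    (h : lift p t c ∣ mk p t w) : c ∣ constantCoeff w := by
  obtain ⟨z, hz⟩ := h
  obtain ⟨z, rfl⟩ := mk_surjective z
  have h0 : mk p t (w - teichmuller p c * z) = 0 := by
    rw [map_sub, hz, map_mul, lift_apply, sub_self]
  obtain ⟨y, hy⟩ := mk_eq_zero_iff.1 h0
  have h1 := congrArg constantCoeff hy
  rw [map_sub, map_mul, map_mul, map_sub, constantCoeff_p, constantCoeff_teichmuller,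
    constantCoeff_teichmuller, zero_sub, sub_eq_iff_eq_add] at h1
  rw [h1]
  exact dvd_add ((dvd_neg.2 hc).mul_right _) (dvd_mul_right _ _)

theorem lift_dvd_of_dvd_constantCoeff {c : O} (hc : c ∣ t) {w : WittVector p O}
    (h : c ∣ constantCoeff w) : lift p t c ∣ mk p t w := by
  obtain ⟨e, he⟩ := h
  obtain ⟨b, hb⟩ := exists_eq_lift_add (t := t) (w := w) rfl (c := constantCoeff w) (by simp)
  rw [hb, he, map_mul, p_eq_lift]
  exact dvd_add (dvd_mul_right _ _) ((map_dvd _ hc).mul_right _)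

theorem exists_associated_lift_of_dvd (ht : t ≠ 0) [IsDomain (Untilt p t)] {b : Untilt p t}
    (hb0 : b ≠ 0) (hb : b ∣ (p : Untilt p t)) :
    ∃ c : O, c ≠ 0 ∧ c ∣ t ∧ Associated (lift p t c) b := by
  obtain ⟨c, hc, hcb⟩ := exists_associated_lift ht hb0
  rcases ValuationRing.dvd_total c t with h | h
  · exact ⟨c, hc, h, hcb⟩
  · refine ⟨t, ht, dvd_rfl, associated_of_dvd_dvd ((map_dvd _ h).trans hcb.dvd) ?_⟩
    rwa [← p_eq_lift]

/-- Balls whose radii divide `p` depend only on residues modulo `p`, that is, on `O` modulo `t`, so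
the family can be transferred to `O`. -/
theorem exists_common_point_of_dvd (ht : t ≠ 0) (hsph : IsSphericallyComplete O)
    [IsDomain (Untilt p t)]
    (S : Set (Untilt p t × Untilt p t)) (hS1 : ∀ q ∈ S, q.2 ∣ (p : Untilt p t))
    (hS0 : ∀ q ∈ S, q.2 ≠ 0)
    (hS : ∀ q ∈ S, ∀ r ∈ S, q.2 ∣ q.1 - r.1 ∨ r.2 ∣ q.1 - r.1) :
    ∃ x, ∀ q ∈ S, q.2 ∣ x - q.1 := by
  obtain ⟨x, hx⟩ := hsph {τ | τ.2 ≠ 0 ∧ τ.2 ∣ t ∧ ∃ q ∈ S, ∃ w, mk p t w = q.1 ∧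
      constantCoeff w = τ.1 ∧ Associated (lift p t τ.2) q.2} (fun τ hτ => hτ.1) (by
    rintro τ ⟨-, hτ, q, hq, w, hw, hwτ, hqτ⟩ υ ⟨-, hυ, r, hr, v, hv, hvυ, hrυ⟩
    have e : τ.1 - υ.1 = constantCoeff (w - v) := by rw [map_sub, hwτ, hvυ]
    have e' : q.1 - r.1 = mk p t (w - v) := by rw [map_sub, hw, hv]
    have h := hS q hq r hr
    rw [e'] at h
    rw [e]
    exact h.imp (fun h => dvd_constantCoeff_of_lift_dvd hτ (hqτ.dvd.trans h))
      (fun h => dvd_constantCoeff_of_lift_dvd hυ (hrυ.dvd.trans h)))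
  refine ⟨lift p t x, fun q hq => ?_⟩
  obtain ⟨c, hc, hct, hcq⟩ := exists_associated_lift_of_dvd ht (hS0 q hq) (hS1 q hq)
  obtain ⟨w, hw⟩ := mk_surjective q.1
  have h := hx (constantCoeff w, c) ⟨hc, hct, q, hq, w, hw, rfl, hcq⟩
  refine hcq.symm.dvd.trans ?_
  rw [← hw, lift_apply (c := x), ← map_sub]
  apply lift_dvd_of_dvd_constantCoeff hct
  rwa [map_sub, constantCoeff_teichmuller]

/-- If the radii become arbitrarily divisible by `p`, the centres converge `p`-adically. Otherwise
rescaling by the largest power of `p` dividing some radius reduces to `exists_common_point_of_dvd`.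
-/
theorem isSphericallyComplete (ht : t ≠ 0) (htu : ¬ IsUnit t)
    (hrank : ∀ c : O, c ≠ 0 → ∃ n, c ∣ t ^ n) (hsph : IsSphericallyComplete O)
    [IsDomain (Untilt p t)] : IsSphericallyComplete (Untilt p t) := by
  classical
  have := valuationRing (p := p) ht
  intro S hS0 hS
  by_cases hcase : ∀ n, ∃ q ∈ S, (p : Untilt p t) ^ n ∣ q.2
  · choose s hsS hs using hcase
    obtain ⟨x, hx⟩ := exists_limit (fun n => (s n).1) fun n => by
      rcases hS _ (hsS (n + 1)) _ (hsS n) with h | h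
      · exact ((pow_dvd_pow _ n.le_succ).trans (hs (n + 1))).trans h
      · exact (hs n).trans h
    refine ⟨x, fun q hq => ?_⟩
    obtain ⟨m, hm⟩ := dvd_p_pow ht hrank (hS0 q hq)
    have h1 : q.2 ∣ (s m).1 - q.1 := by
      rcases hS _ (hsS m) _ hq with h | h
      · exact (hm.trans (hs m)).trans h
      · exact h
    have := dvd_add (hm.trans (hx m)) h1
    rwa [sub_add_sub_cancel] at this
  · push Not at hcase
    have hn := Nat.find_spec hcase
    rcases hfind : Nat.find hcase with _ | m
    · refine ⟨0, fun q hq => absurd ?_ (hn q hq)⟩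
      rw [hfind, pow_zero]
      exact one_dvd _
    rw [hfind] at hn
    obtain ⟨s, hs, hsm⟩ : ∃ q ∈ S, (p : Untilt p t) ^ m ∣ q.2 := by
      by_contra! h
      have := Nat.find_min' hcase h
      omega
    have hp : (p : Untilt p t) ^ m ≠ 0 := p_pow_ne_zero ht htu m
    obtain ⟨x, hx⟩ := exists_common_point_of_dvd ht hsph
      {τ | (s.1 + (p : Untilt p t) ^ m * τ.1, (p : Untilt p t) ^ m * τ.2) ∈ S}
      (fun τ hτ => by
        have := (ValuationRing.dvd_total _ _).resolve_right
          (hn _ hτ)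
        rw [pow_succ] at this
        exact (mul_dvd_mul_iff_left hp).1 this)
      (fun τ hτ e => hS0 _ hτ (by rw [e, mul_zero]))
      (fun τ hτ υ hυ => by
        have := hS _ hτ _ hυ
        rw [add_sub_add_left_eq_sub, ← mul_sub] at this
        exact this.imp (mul_dvd_mul_iff_left hp).1 (mul_dvd_mul_iff_left hp).1)
    refine ⟨s.1 + p ^ m * x, fun q hq => ?_⟩
    by_cases hqm : (p : Untilt p t) ^ m ∣ q.2
    · obtain ⟨b, hb⟩ := hqm
      have hsub : (p : Untilt p t) ^ m ∣ q.1 - s.1 := by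
        rcases hS q hq s hs with h | h
        · exact (Dvd.intro b hb.symm).trans h
        · exact hsm.trans h
      obtain ⟨a, ha⟩ := hsub
      have hq' : q = (s.1 + p ^ m * a, p ^ m * b) := by
        rw [← ha, ← hb, add_sub_cancel]
      have h := hx (a, b) (by change _ ∈ S; rwa [← hq'])
      rw [hq']
      simp only [add_sub_add_left_eq_sub, ← mul_sub]
      exact mul_dvd_mul_left _ h
    -- A ball of radius larger than `p ^ m` contains the ball of `s` and every rescaled candidate.
    · have h1 : q.2 ∣ (p : Untilt p t) ^ m :=
        (ValuationRing.dvd_total _ _).resolve_right hqm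
      have h2 : q.2 ∣ s.1 - q.1 := by
        rcases hS s hs q hq with h | h
        · exact (h1.trans hsm).trans h
        · exact h
      have := dvd_add h2 (h1.mul_right x)
      rwa [sub_add_eq_add_sub] at this

/-- The residue map of the untilt induced by a map from `O` that kills `t`. -/
noncomputable def residue {k : Type*} [Field k] (π : O →+* k) (hπ : π t = 0) :
    Untilt p t →+* k :=
  Ideal.Quotient.lift _ (π.comp constantCoeff) (by
    intro a ha
    obtain ⟨y, rfl⟩ := Ideal.mem_span_singleton.1 ha
    rw [RingHom.comp_apply, map_mul, map_sub, constantCoeff_p, constantCoeff_teichmuller, map_mul,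
      map_sub, hπ, map_zero, sub_zero, zero_mul])

theorem residue_lift {k : Type*} [Field k] (π : O →+* k) (hπ : π t = 0) (c : O) :
    residue (p := p) π hπ (lift p t c) = π c :=
  congrArg π (constantCoeff_teichmuller (p := p) c)

theorem charZero (ht : t ≠ 0) (htu : ¬ IsUnit t) [IsDomain (Untilt p t)] {k : Type*} [Field k]
    (π : O →+* k) (hπ : π t = 0) : CharZero (Untilt p t) := by
  have hpk : (p : k) = 0 := by rw [← map_natCast π, CharP.cast_eq_zero, map_zero]
  obtain ⟨q, hq⟩ := CharP.exists (Untilt p t)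
  rcases CharP.char_is_prime_or_zero (Untilt p t) q with hqp | rfl
  · exfalso
    have hqk : (q : k) = 0 := by
      have h := congrArg (residue (p := p) π hπ) (CharP.cast_eq_zero (Untilt p t) q)
      rwa [map_natCast, map_zero] at h
    rcases eq_or_ne q p with rfl | hne
    · exact p_pow_ne_zero (p := q) ht htu 1 (by rw [pow_one, CharP.cast_eq_zero])
    · obtain ⟨a, b, hab⟩ := Nat.isCoprime_iff_coprime.2
        ((Nat.coprime_primes hqp (Fact.out : p.Prime)).2 hne)
      have := congrArg (Int.cast : ℤ → k) hab
      simp [hqk, hpk] at this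
  · exact CharP.charP_to_charZero _

section Action

variable {G : Type*} [Group G] (ρ : G →* (O →+* O)) (hρ : ∀ g, ρ g t = t)

/-- The action on the untilt induced by an action on `O` fixing `t`. -/
noncomputable def mapEndHom : G →* (Untilt p t →+* Untilt p t) where
  toFun g := Ideal.quotientMap _ (WittVector.map (ρ g)) (by
    rw [Ideal.span_singleton_le_iff_mem, Ideal.mem_comap, map_sub, map_natCast, map_teichmuller,
      hρ]
    exact Ideal.mem_span_singleton_self _)
  map_one' := by
    refine Ideal.Quotient.ringHom_ext (RingHom.ext fun w => congrArg (mk p t) ?_)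
    ext n
    simp
  map_mul' g h := by
    refine Ideal.Quotient.ringHom_ext (RingHom.ext fun w => congrArg (mk p t) ?_)
    ext n
    simp

theorem mapEndHom_lift (g : G) (c : O) :
    mapEndHom ρ hρ g (lift p t c) = lift p t (ρ g c) :=
  congrArg (mk p t) (map_teichmuller p (ρ g) c)

variable [TopologicalSpace G] (τ : O → O) (hτ : ∀ c, t ∣ c - τ c)
  (hτ' : ∀ c d, t ∣ c - d → τ c = τ d) (hρτ : ∀ g c, ρ g (τ c) = τ (ρ g c))

-- The map `τ` chooses representatives modulo `t` equivariantly. Expanding `a = [c] + p b` with such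
-- a digit `c`, being fixed modulo `p ^ (n + 1)` means that `c` is fixed and `b` is fixed modulo `p
-- ^ n`.
include hτ hτ' hρτ in
theorem isClosed_dvd_sub (ht : t ≠ 0) (htu : ¬ IsUnit t) [IsDomain (Untilt p t)]
    (hcl : ∀ c, IsClosed {g | ρ g c = c}) (n : ℕ) (a : Untilt p t) :
    IsClosed {g | (p : Untilt p t) ^ n ∣ mapEndHom ρ hρ g a - a} := by
  induction n generalizing a with
  | zero => simp
  | succ n ih =>
    obtain ⟨w, hw⟩ := mk_surjective a
    obtain ⟨b, hb⟩ := exists_eq_lift_add hw (hτ (constantCoeff w))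
    set c := τ (constantCoeff w) with hc
    have hττ : τ c = c := (hτ' _ _ (hτ _)).symm
    have hp : (p : Untilt p t) ≠ 0 := by simpa using p_pow_ne_zero (p := p) ht htu 1
    have e : {g | (p : Untilt p t) ^ (n + 1) ∣ mapEndHom ρ hρ g a - a} =
        {g | ρ g c = c} ∩ {g | (p : Untilt p t) ^ n ∣ mapEndHom ρ hρ g b - b} := by
      ext g
      simp only [Set.mem_ofPred_eq, Set.mem_inter_iff]
      have h1 : mapEndHom ρ hρ g a - a = (lift p t (ρ g c) - lift p t c) +
          p * (mapEndHom ρ hρ g b - b) := by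
        rw [hb, map_add, mapEndHom_lift, map_mul, map_natCast]
        ring
      have h2 : (p : Untilt p t) ^ (n + 1) ∣ mapEndHom ρ hρ g a - a → ρ g c = c := by
        intro h
        have h3 := (dvd_pow_self _ n.succ_ne_zero).trans h
        rw [h1, dvd_add_left (dvd_mul_right _ _), lift_apply, lift_apply, ← map_sub, dvd_mk_iff,
          map_sub, constantCoeff_teichmuller, constantCoeff_teichmuller] at h3
        rw [← hττ, hρτ]
        exact hτ' _ _ h3
      constructor
      · intro h
        have hg := h2 h
        rw [h1, hg, sub_self, zero_add, pow_succ', mul_dvd_mul_iff_left hp] at h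
        exact ⟨hg, h⟩
      · rintro ⟨hg, h⟩
        rw [h1, hg, sub_self, zero_add, pow_succ', mul_dvd_mul_iff_left hp]
        exact h
    rw [e]
    exact (hcl c).inter (ih b)

include hτ hτ' hρτ in
theorem isClosed_stabilizer (ht : t ≠ 0) (htu : ¬ IsUnit t) [IsDomain (Untilt p t)]
    (hcl : ∀ c, IsClosed {g | ρ g c = c}) (a : Untilt p t) :
    IsClosed {g | mapEndHom ρ hρ g a = a} := by
  have e : {g | mapEndHom ρ hρ g a = a} =
      ⋂ n : ℕ, {g | (p : Untilt p t) ^ n ∣ mapEndHom ρ hρ g a - a} := by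
    ext g
    simp only [Set.mem_ofPred_eq, Set.mem_iInter]
    constructor
    · intro h n
      rw [h, sub_self]
      exact dvd_zero _
    · exact fun h => sub_eq_zero.1 (eq_zero_of_forall_dvd ht h)
  rw [e]
  exact isClosed_iInter fun n => isClosed_dvd_sub ρ hρ τ hτ hτ' hρτ ht htu hcl n a

end Action

end Untilt

end Untilt

/-! ### Generic models and their lift to characteristic 0 -/

/-- An action on a domain extends to its fraction field. -/
theorem exists_fractionRing_action {G A F : Type*} [Group G] [CommRing A] [IsDomain A] [Field F]
    [Algebra A F] [IsFractionRing A F] (ρ : G →* (A →+* A)) :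
    ∃ ρ' : G →* (F →+* F), ∀ g a, ρ' g (algebraMap A F a) = algebraMap A F (ρ g a) := by
  have hinj : ∀ g, Function.Injective ((algebraMap A F).comp (ρ g)) := by
    intro g
    refine (IsFractionRing.injective A F).comp (Function.LeftInverse.injective (g := ρ g⁻¹) ?_)
    intro a
    have h : ρ g⁻¹ * ρ g = 1 := by rw [← map_mul, inv_mul_cancel, map_one]
    exact DFunLike.congr_fun h a
  refine ⟨⟨⟨fun g => IsFractionRing.lift (hinj g), ?_⟩, ?_⟩, ?_⟩
  · refine IsLocalization.ringHom_ext (nonZeroDivisors A) (RingHom.ext fun a => ?_)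
    simp
  · intro g h
    refine IsLocalization.ringHom_ext (nonZeroDivisors A) (RingHom.ext fun a => ?_)
    simp
  · intro g a
    simp

/-- An algebraically closed field with an action of `G` having closed stabilizers, together with
a `G`-equivariant family of elements, indexed by the `G`-set `J`, which is algebraically
independent over `ℤ` (if `p = 0`) or `ZMod p`. -/
def HasGenericModel (p : ℕ) {G J : Type u} [Group G] [TopologicalSpace G]
    (a : G →* Equiv.Perm J) : Prop :=
  ∃ (F : Type u) (_ : Field F) (_ : IsAlgClosed F) (ρ : G →* (F →+* F)) (φ : ZMod p →+* F)
    (y : J → F), (∀ c, IsClosed {g | ρ g c = c}) ∧ (∀ g j, ρ g (y j) = y (a g j)) ∧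
      Function.Injective (MvPolynomial.eval₂Hom φ y)

section Mixed

open HahnSeries

theorem MvPolynomial.eq_zero_of_forall_natCast_pow_dvd {J : Type*} {p : ℕ} (hp : p.Prime)
    {f : MvPolynomial J ℤ} (hf : ∀ n m, (p : ℤ) ^ n ∣ f.coeff m) : f = 0 := by
  ext m
  rw [coeff_zero]
  by_contra hne
  exact not_lt.2 (Int.le_of_dvd (abs_pos.2 hne) ((dvd_abs _ _).2 (hf (f.coeff m).natAbs m)))
    (by
      rw [Int.abs_eq_natAbs]
      exact_mod_cast Nat.lt_pow_self hp.one_lt)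

/-- Lifting generic models from characteristic `p` to characteristic `0`. -/
theorem HasGenericModel.charZero {p : ℕ} (hp : p.Prime) {G J : Type u} [Group G]
    [TopologicalSpace G] {a : G →* Equiv.Perm J} (h : HasGenericModel p a) :
    HasGenericModel 0 a := by
  have : Fact p.Prime := ⟨hp⟩
  obtain ⟨k, _, _, ρ, φ, y, hcl, hy, hinj⟩ := h
  have : CharP k p := charP_of_injective_ringHom φ.injective p
  have hΓ : ∀ (γ : ℚ) (n : ℕ), n ≠ 0 → ∃ δ : ℚ, n • δ = γ := fun γ n hn =>
    ⟨γ / n, by rw [nsmul_eq_mul]; field_simp⟩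
  have : CharP (integers ℚ k) p := charP_integers p
  have : PerfectRing (integers ℚ k) p := perfectRing_integers hΓ p
  let t : integers ℚ k := ⟨single 1 1, single_mem_integers zero_le_one 1⟩
  have htord : t.1.orderTop = (1 : ℚ) := orderTop_single one_ne_zero
  have ht : t ≠ 0 := fun e => single_ne_zero (Γ := ℚ) (a := 1) (one_ne_zero (α := k))
    (congrArg Subtype.val e)
  have hπt : integersResidue ℚ k t = 0 := coeff_single_of_ne zero_ne_one
  have htu : ¬ IsUnit t := fun hu => (hu.map (integersResidue ℚ k)).ne_zero hπt
  have hrank : ∀ c : integers ℚ k, c ≠ 0 → ∃ n, c ∣ t ^ n := by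
    intro c hc
    have hc' : c.1 ≠ 0 := fun e => hc (Subtype.ext e)
    obtain ⟨n, hn⟩ := exists_nat_ge c.1.order
    refine ⟨n, dvd_integers_iff.2 ?_⟩
    change _ ≤ ((single 1 1 : HahnSeries ℚ k) ^ n).orderTop
    rw [single_pow, one_pow, orderTop_single one_ne_zero, ← order_eq_orderTop_of_ne_zero hc']
    exact WithTop.coe_le_coe.2 (by simpa using hn)
  have hdom : IsDomain (Untilt p t) := Untilt.isDomain ht htu hrank
  have := Untilt.valuationRing (p := p) ht
  let F := FractionRing (Untilt p t)
  have hAlg : IsAlgClosed F := isAlgClosed_of_isSphericallyComplete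
    (Untilt.residue (p := p) (integersResidue ℚ k) hπt)
    (fun c => by
      obtain ⟨b, hb⟩ := integersResidue_surjective (Γ := ℚ) c
      exact ⟨Untilt.lift p t b, by rw [Untilt.residue_lift, hb]⟩)
    (Untilt.hasRootsUpToUnits ht (hasRootsUpToUnits_integers hΓ))
    (Untilt.isSphericallyComplete ht htu hrank isSphericallyComplete_integers)
  have hchar : CharZero (Untilt p t) := Untilt.charZero ht htu (integersResidue ℚ k) hπt
  let ρO : G →* (integers ℚ k →+* integers ℚ k) := integersMapEndHom.comp ρ
  have hρt : ∀ g, ρO g t = t := fun g => Subtype.ext ((mapEndHom_single (ρ g) 1 1).trans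
    (by rw [map_one]))
  have hclO : ∀ c, IsClosed {g | ρO g c = c} := by
    intro c
    have e : {g | ρO g c = c} = ⋂ γ : ℚ, {g | ρ g (c.1.coeff γ) = c.1.coeff γ} := by
      ext g
      simp only [Set.mem_ofPred_eq, Set.mem_iInter]
      constructor
      · intro h γ
        conv_rhs => rw [← h]
        rfl
      · intro h
        ext γ
        exact h γ
    rw [e]
    exact isClosed_iInter fun γ => hcl _
  have htdvd : ∀ c : integers ℚ k, t ∣ c ↔ ∀ γ : ℚ, γ < 1 → c.1.coeff γ = 0 := by
    intro c
    rw [dvd_integers_iff, htord, le_orderTop_iff_forall]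
    simp only [WithTop.coe_lt_coe]
  -- Truncation below exponent 1, the exponent of `t`, represents classes modulo `t` and commutes
  -- with any action on coefficients.
  let τ : integers ℚ k → integers ℚ k := fun c => ⟨truncLT 1 c.1, by
    rw [mem_integers_iff, le_orderTop_iff_forall]
    intro γ hγ
    rw [HahnSeries.coeff_truncLT, coeff_eq_zero_of_lt_orderTop
      (hγ.trans_le (mem_integers_iff.1 c.2)), ite_self]⟩
  have hτ : ∀ c, t ∣ c - τ c := by
    intro c
    rw [htdvd]
    intro γ hγ
    change (c.1 - truncLT 1 c.1).coeff γ = 0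
    rw [coeff_sub, coeff_truncLT_of_lt hγ, sub_self]
  have hτ' : ∀ c d, t ∣ c - d → τ c = τ d := by
    intro c d h
    rw [htdvd] at h
    ext γ
    change (truncLT 1 c.1).coeff γ = (truncLT 1 d.1).coeff γ
    rw [HahnSeries.coeff_truncLT, HahnSeries.coeff_truncLT]
    split_ifs with hγ
    · have h' : (c.1 - d.1).coeff γ = 0 := h γ hγ
      rwa [coeff_sub, sub_eq_zero] at h'
    · rfl
  have hρτ : ∀ g c, ρO g (τ c) = τ (ρO g c) := by
    intro g c
    ext γ
    change (mapEndHom (ρ g) (truncLT 1 c.1)).coeff γ = (truncLT 1 (mapEndHom (ρ g) c.1)).coeff γ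
    rw [mapEndHom_coeff, HahnSeries.coeff_truncLT, HahnSeries.coeff_truncLT, mapEndHom_coeff]
    split_ifs
    · rfl
    · rw [map_zero]
  let ρA := Untilt.mapEndHom (p := p) ρO hρt
  have hclA : ∀ x, IsClosed {g | ρA g x = x} :=
    Untilt.isClosed_stabilizer ρO hρt τ hτ hτ' hρτ ht htu hclO
  obtain ⟨ρF, hρF⟩ := exists_fractionRing_action (F := F) ρA
  let z : J → Untilt p t := fun j =>
    Untilt.lift p t ⟨single 0 (y j), single_mem_integers le_rfl _⟩
  refine ⟨F, inferInstance, hAlg, ρF, Int.castRingHom F, fun j => algebraMap _ F (z j), ?_, ?_, ?_⟩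
  · intro c
    obtain ⟨x, b, hb, rfl⟩ := IsFractionRing.div_surjective (A := Untilt p t) c
    have hb0 : b ≠ 0 := nonZeroDivisors.ne_zero hb
    obtain ⟨n, d, hd⟩ := Untilt.dvd_p_pow ht hrank hb0
    have hinj := IsFractionRing.injective (Untilt p t) F
    have hpn : (p : F) ^ n ≠ 0 := by
      have := (map_ne_zero_iff _ hinj).2 (Untilt.p_pow_ne_zero (p := p) ht htu n)
      rwa [map_pow, map_natCast] at this
    have hd0 : algebraMap (Untilt p t) F d ≠ 0 := by
      rw [map_ne_zero_iff _ hinj]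
      rintro rfl
      exact Untilt.p_pow_ne_zero ht htu n (by rw [hd, mul_zero])
    -- Every denominator divides a power of `p`, which the group fixes; the stabilizer of a fraction
    -- is thus that of an element of the untilt.
    have e : algebraMap _ F x / algebraMap _ F b = algebraMap _ F (x * d) / (p : F) ^ n := by
      have h1 : (p : F) ^ n = algebraMap _ F b * algebraMap _ F d := by
        rw [← map_mul, ← hd, map_pow, map_natCast]
      rw [h1, map_mul, mul_div_mul_right _ _ hd0]
    rw [e]
    convert hclA (x * d) using 1
    ext g
    simp only [Set.mem_ofPred_eq]
    rw [map_div₀, map_pow, map_natCast, div_left_inj' hpn, hρF, hinj.eq_iff]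
  · intro g j
    have h1 : ρO g ⟨single 0 (y j), single_mem_integers le_rfl _⟩ =
        ⟨single 0 (y (a g j)), single_mem_integers le_rfl _⟩ :=
      Subtype.ext ((mapEndHom_single (ρ g) 0 (y j)).trans (by rw [hy]))
    rw [hρF, Untilt.mapEndHom_lift, h1]
  · rw [injective_iff_map_eq_zero]
    -- A relation over `ℤ` reduces to one between the `y j` over `ZMod p`, hence is divisible by
    -- `p`; dividing by `p` leaves a relation, so this can be repeated.
    have key : ∀ n, ∀ f : MvPolynomial J ℤ,
        MvPolynomial.eval₂Hom (Int.castRingHom F) (fun j => algebraMap _ F (z j)) f = 0 →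
          ∀ m, (p : ℤ) ^ n ∣ f.coeff m := by
      intro n
      induction n with
      | zero => intro f _ m; simp
      | succ n ih =>
        intro f hf
        have h1 : MvPolynomial.eval₂Hom (Int.castRingHom (Untilt p t)) z f = 0 := by
          apply IsFractionRing.injective (Untilt p t) F
          rw [map_zero, ← hf]
          exact MvPolynomial.map_eval₂Hom _ _ _ f |>.trans (by congr 2; ext; simp)
        have h2 : MvPolynomial.eval₂Hom φ y
            (MvPolynomial.map (Int.castRingHom (ZMod p)) f) = 0 := by
          have h3 := congrArg (Untilt.residue (p := p) (integersResidue ℚ k) hπt) h1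
          rw [map_zero] at h3
          rw [← h3, MvPolynomial.map_eval₂Hom, MvPolynomial.coe_eval₂Hom,
            MvPolynomial.eval₂_map, MvPolynomial.coe_eval₂Hom]
          congr 1
          · ext; simp
          · funext j
            rw [Untilt.residue_lift]
            simp [integersResidue_apply]
        have h4 : MvPolynomial.map (Int.castRingHom (ZMod p)) f = 0 :=
          hinj (by rw [h2, map_zero])
        obtain ⟨f', rfl⟩ : MvPolynomial.C (p : ℤ) ∣ f := by
          rw [MvPolynomial.C_dvd_iff_dvd_coeff]
          intro m
          have := congrArg (MvPolynomial.coeff m) h4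
          rw [MvPolynomial.coeff_map, MvPolynomial.coeff_zero] at this
          exact (ZMod.intCast_zmod_eq_zero_iff_dvd _ p).1 this
        intro m
        rw [map_mul, mul_eq_zero] at hf
        have hpF : (p : F) ≠ 0 := by
          have := (map_ne_zero_iff _ (IsFractionRing.injective (Untilt p t) F)).2
            (Untilt.p_pow_ne_zero (p := p) ht htu 1)
          rwa [pow_one, map_natCast] at this
        have hf' := hf.resolve_left (by simpa using hpF)
        rw [MvPolynomial.coeff_C_mul, pow_succ']
        exact mul_dvd_mul_left _ (ih f' hf' m)
    intro f hf
    exact MvPolynomial.eq_zero_of_forall_natCast_pow_dvd hp fun n => key n f hf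
end Mixed

/-! ### Algebraically independent families -/

section Generic

open HahnSeries

/-- The exponents of monomials, inside the lexicographically ordered rational exponents. -/
noncomputable def monomialExponent (I : Type*) : (I →₀ ℕ) →+ Lex (I →₀ ℚ) :=
  (toLexAddEquiv (I →₀ ℚ)).toAddMonoidHom.comp
    (Finsupp.mapRange.addMonoidHom (Nat.castAddMonoidHom ℚ))

theorem monomialExponent_injective (I : Type*) : Function.Injective (monomialExponent I) := by
  intro s s' h
  have h1 : Finsupp.mapRange (Nat.cast : ℕ → ℚ) Nat.cast_zero s =
      Finsupp.mapRange Nat.cast Nat.cast_zero s' := toLex.injective h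
  exact Finsupp.mapRange_injective _ _ Nat.cast_injective h1

/-- Distinct monomials become Hahn monomials with distinct exponents, so the coefficients of a
polynomial are read off from its image. -/
theorem eval₂Hom_single_injective (I k : Type*) [LinearOrder I] [Field k] :
    Function.Injective (MvPolynomial.eval₂Hom (C : k →+* HahnSeries (Lex (I →₀ ℚ)) k)
      (fun i => single (monomialExponent I (Finsupp.single i 1)) (1 : k))) := by
  rw [injective_iff_map_eq_zero]
  intro f hf
  have hmon : ∀ s : I →₀ ℕ, (s.prod fun i n =>
      (single (monomialExponent I (Finsupp.single i 1)) (1 : k)) ^ n) =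
      single (monomialExponent I s) 1 := by
    intro s
    induction s using Finsupp.induction_linear with
    | zero => simp
    | add s s' h h' =>
      rw [Finsupp.prod_add_index' (by simp) (by intros; rw [_root_.pow_add]), h, h',
        single_mul_single,
        map_add, one_mul]
    | single i n =>
      rw [Finsupp.prod_single_index (by simp), single_pow, one_pow, ← map_nsmul,
        Finsupp.smul_single, smul_eq_mul, mul_one]
  have key : ∀ (g : MvPolynomial I k) (m : I →₀ ℕ),
      (MvPolynomial.eval₂Hom (C : k →+* HahnSeries (Lex (I →₀ ℚ)) k)
        (fun i => single (monomialExponent I (Finsupp.single i 1)) (1 : k)) g).coeff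
          (monomialExponent I m) = g.coeff m := by
    intro g m
    classical
    induction g using MvPolynomial.induction_on' with
    | monomial s c =>
      rw [MvPolynomial.coe_eval₂Hom, MvPolynomial.eval₂_monomial, hmon, C_apply,
        single_mul_single, zero_add, mul_one, MvPolynomial.coeff_monomial, coeff_single,
        (monomialExponent_injective I).eq_iff]
      split_ifs with h1 h2 h2 <;> simp_all
    | add g g' h h' => rw [map_add, coeff_add, MvPolynomial.coeff_add, h, h']
  ext m
  rw [← key, hf, coeff_zero, MvPolynomial.coeff_zero]

/-- Generic combinations of algebraically independent elements, with Vandermonde coefficients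
along finite blocks, are algebraically independent. -/
theorem eval₂Hom_vandermonde_injective {J k R : Type*} [Field k] [Infinite k] [CommRing R]
    (ψ : k →+* R) (t : J × ℕ → R) (ht : Function.Injective (MvPolynomial.eval₂Hom ψ t))
    (θ : J → k) (r : J → J) (s : J → Finset J) (hs : ∀ j, j ∈ s (r j))
    (hθ : ∀ j, Set.InjOn θ (s (r j))) :
    Function.Injective (MvPolynomial.eval₂Hom ψ
      (fun j => ∑ m ∈ Finset.range (s (r j)).card, ψ (θ j) ^ m * t (r j, m))) := by
  classical
  let Y : J → MvPolynomial (J × ℕ) k := fun j =>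
    ∑ m ∈ Finset.range (s (r j)).card, MvPolynomial.C (θ j ^ m) * MvPolynomial.X (r j, m)
  rw [injective_iff_map_eq_zero]
  intro f hf
  have h1 : MvPolynomial.eval₂Hom MvPolynomial.C Y f = 0 := by
    apply ht
    rw [map_zero, ← hf, MvPolynomial.map_eval₂Hom]
    congr 1
    congr 1
    · ext; simp
    · funext j
      simp [Y]
  refine MvPolynomial.funext fun v => ?_
  rw [map_zero]
  -- Interpolating prescribed values `v` on each block at the nodes `θ` gives values of the `t`
  -- variables at which every `Y j` equals `v j`. So `f` vanishes at all points over the infinite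
  -- field `k`.
  let v' : J × ℕ → k := fun q => (Lagrange.interpolate (s q.1) θ v).coeff q.2
  have hY : ∀ j, MvPolynomial.eval v' (Y j) = v j := by
    intro j
    simp only [Y, map_sum, map_mul, MvPolynomial.eval_C, MvPolynomial.eval_X]
    conv_rhs => rw [← Lagrange.eval_interpolate_at_node v (hθ j) (hs j)]
    have hdeg := Lagrange.degree_interpolate_lt v (hθ j)
    have hnat : (Lagrange.interpolate (s (r j)) θ v).natDegree < (s (r j)).card := by
      by_cases h0 : Lagrange.interpolate (s (r j)) θ v = 0
      · rw [h0, Polynomial.natDegree_zero]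
        exact Finset.card_pos.2 ⟨j, hs j⟩
      · exact (Polynomial.natDegree_lt_iff_degree_lt h0).2 hdeg
    rw [Polynomial.eval_eq_sum_range' hnat]
    exact Finset.sum_congr rfl fun m _ => mul_comm _ _
  have h2 := congrArg (MvPolynomial.eval v') h1
  rw [map_zero, MvPolynomial.map_eval₂Hom] at h2
  rw [← h2]
  simp only [hY]
  congr 1
  ext <;> simp

end Generic

/-! ### Generic models for absolute Galois groups -/

section AbsGalois

variable (K : Type u) [Field K]

/-- The absolute Galois group acts on the algebraic closure with open stabilizers. -/
theorem exists_absGaloisGroup_action :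
    ∃ ρ : AbsGaloisGroup K →* (AlgebraicClosure K →+* AlgebraicClosure K),
      (∀ g (x : SeparableClosure K), ρ g x = g x) ∧ ∀ c, IsClosed {g | ρ g c = c} := by
  let k := AlgebraicClosure K
  let S := SeparableClosure K
  obtain ⟨q, hq⟩ := ExpChar.exists K
  have : ExpChar S q := expChar_of_injective_algebraMap (algebraMap K S).injective q
  have : ExpChar k q := expChar_of_injective_algebraMap (algebraMap K k).injective q
  -- The algebraic closure is purely inseparable over the separable closure, so automorphisms extend
  -- uniquely, and `c` has the same stabilizer as its separable power.
  have hpi : ∀ x : k, ∃ n : ℕ, ∃ y : S, (y : k) = x ^ q ^ n := fun x => by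
    obtain ⟨n, y, hy⟩ := IsPurelyInseparable.pow_mem S q x
    exact ⟨n, y, hy⟩
  let res : Gal(k/K) →* Gal(S/K) := AlgEquiv.restrictNormalHom S
  have hres : ∀ (g : Gal(k/K)) (x : S), ((res g x : S) : k) = g x := fun g x =>
    AlgEquiv.restrictNormal_commutes g S x
  have hinj : Function.Injective res := by
    rw [injective_iff_map_eq_one]
    intro g hg
    ext x
    obtain ⟨n, y, hy⟩ := hpi x
    apply iterateFrobenius_inj k q n
    rw [iterateFrobenius_def, iterateFrobenius_def, ← map_pow]
    change g _ = x ^ q ^ n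
    rw [← hy, ← hres, hg]
    rfl
  have hsurj : Function.Surjective res := AlgEquiv.restrictNormalHom_surjective k
  let e : Gal(k/K) ≃* Gal(S/K) := MulEquiv.ofBijective res ⟨hinj, hsurj⟩
  let ρ : Gal(S/K) →* (k →+* k) :=
    { toFun g := (e.symm g : k ≃ₐ[K] k)
      map_one' := by rw [map_one]; rfl
      map_mul' g h := by rw [map_mul]; rfl }
  have hρ : ∀ g (x : S), ρ g x = g x := fun g x => by
    have h1 : e (e.symm g) = g := e.apply_symm_apply g
    conv_rhs => rw [← h1]
    exact (hres _ x).symm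
  refine ⟨ρ, hρ, fun c => ?_⟩
  obtain ⟨n, y, hy⟩ := hpi c
  have h1 : {g | ρ g c = c} = (MulAction.stabilizer Gal(S/K) y : Set Gal(S/K)) := by
    ext g
    simp only [Set.mem_ofPred_eq, SetLike.mem_coe, MulAction.mem_stabilizer_iff]
    rw [← (iterateFrobenius_inj k q n).eq_iff, iterateFrobenius_def, iterateFrobenius_def,
      ← map_pow, ← hy, hρ]
    exact Subtype.ext_iff.symm
  rw [h1]
  exact Subgroup.isClosed_of_isOpen _ (stabilizer_isOpen_of_isIntegral y)

/-- Every open subgroup of the absolute Galois group is the stabilizer of an element. -/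
theorem exists_stabilizer_eq (H : Subgroup (AbsGaloisGroup K))
    (hH : IsOpen (H : Set (AbsGaloisGroup K))) :
    ∃ θ : SeparableClosure K, ∀ g : AbsGaloisGroup K, g θ = θ ↔ g ∈ H := by
  let H' : ClosedSubgroup (AbsGaloisGroup K) := ⟨H, Subgroup.isClosed_of_isOpen _ hH⟩
  have hfix := InfiniteGalois.fixingSubgroup_fixedField H'
  set E := IntermediateField.fixedField (H' : Subgroup (AbsGaloisGroup K)) with hE
  have : FiniteDimensional K E := by
    rw [← InfiniteGalois.isOpen_iff_finite]
    change IsOpen (E.fixingSubgroup : Set (AbsGaloisGroup K))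
    rw [hfix]
    exact hH
  -- The stabilizer of a primitive element of the fixed field is the given open subgroup.
  let B := Field.powerBasisOfFiniteOfSeparable K E
  refine ⟨(B.gen : E), fun g => ⟨fun hg => ?_, fun hg => B.gen.2 ⟨g, hg⟩⟩⟩
  have h2 : g ∈ E.fixingSubgroup := by
    have h3 : (g : SeparableClosure K →ₐ[K] SeparableClosure K).comp E.val = E.val :=
      B.algHom_ext hg
    intro x
    exact DFunLike.congr_fun h3 x
  rw [hfix] at h2
  exact h2

/-- Open stabilizers make the orbits in `J` finite, and each orbit embeds equivariantly in the
separable closure by `θ`. Combining group-fixed Hahn monomials with powers of `θ j` as coefficients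
gives elements permuted like `J`, independent because `θ` is injective on each orbit. -/
theorem hasGenericModel_of_charP (p : ℕ) [CharP K p] {J : Type u}
    (a : AbsGaloisGroup K →* Equiv.Perm J)
    (ha : ∀ j, IsOpen {g | a g j = j}) : HasGenericModel p a := by
  classical
  let : MulAction (AbsGaloisGroup K) J := MulAction.compHom J a
  obtain ⟨ρ, hρ, hcl⟩ := exists_absGaloisGroup_action K
  have hstab : ∀ j : J, ∃ θ : SeparableClosure K, ∀ g : AbsGaloisGroup K,
      g θ = θ ↔ g • j = j := fun j =>
    exists_stabilizer_eq K (MulAction.stabilizer (AbsGaloisGroup K) j) (ha j)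
  choose θ₀ hθ₀ using hstab
  -- `r j` is the chosen representative of the orbit of `j`; below, `γ j` carries it to `j`.
  let r : J → J := fun j => (Quotient.mk (MulAction.orbitRel (AbsGaloisGroup K) J) j).out
  have hr : ∀ j, ∃ g : AbsGaloisGroup K, g • r j = j := fun j => by
    have h := Quotient.mk_out (s := MulAction.orbitRel (AbsGaloisGroup K) J) j
    exact (MulAction.orbitRel (AbsGaloisGroup K) J).symm' h
  choose γ hγ using hr
  have hrg : ∀ (g : AbsGaloisGroup K) j, r (g • j) = r j := fun g j => by
    have : (Quotient.mk (MulAction.orbitRel (AbsGaloisGroup K) J) (g • j)) =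
        Quotient.mk (MulAction.orbitRel (AbsGaloisGroup K) J) j :=
      Quotient.sound ⟨g, rfl⟩
    simp only [r, this]
  let θ : J → SeparableClosure K := fun j => γ j (θ₀ (r j))
  have hθ : ∀ (g : AbsGaloisGroup K) j, g (θ j) = θ (g • j) := by
    intro g j
    have h1 : ((γ (g • j))⁻¹ * (g * γ j)) • r j = r j := by
      rw [mul_smul, mul_smul, hγ, inv_smul_eq_iff, ← hrg g j, hγ]
    have h2 := (hθ₀ _ _).2 h1
    rw [AlgEquiv.mul_apply] at h2
    have h3 := congrArg (γ (g • j)) h2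
    rw [← AlgEquiv.mul_apply, mul_inv_cancel, AlgEquiv.one_apply] at h3
    simp only [θ, hrg]
    exact h3
  have hinj : ∀ j j', r j = r j' → θ j = θ j' → j = j' := by
    intro j j' h h'
    simp only [θ, ← h] at h'
    have h2 : ((γ j')⁻¹ * γ j) (θ₀ (r j)) = θ₀ (r j) := by
      rw [AlgEquiv.mul_apply, h', ← AlgEquiv.mul_apply, inv_mul_cancel, AlgEquiv.one_apply]
    rw [hθ₀, mul_smul, hγ, inv_smul_eq_iff, h, hγ] at h2
    exact h2
  have hfin : ∀ i, {j | r j = i}.Finite := by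
    intro i
    by_cases hi : ∃ j, r j = i
    · obtain ⟨j, rfl⟩ := hi
      have : Finite (AbsGaloisGroup K ⧸ MulAction.stabilizer (AbsGaloisGroup K) (r j)) :=
        Subgroup.quotient_finite_of_isOpen _ (ha _)
      have hf : (MulAction.orbit (AbsGaloisGroup K) (r j)).Finite :=
        Finite.of_equiv _ (MulAction.orbitEquivQuotientStabilizer _ _).symm
      refine hf.subset fun j' hj' => ⟨γ j', ?_⟩
      have hj' : r j' = r j := hj'
      simp only [← hj', hγ]
    · convert Set.finite_empty
      ext j
      simp only [Set.mem_ofPred_eq, Set.mem_empty_iff_false, iff_false]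
      exact fun h => hi ⟨j, h⟩
  let s : J → Finset J := fun i => (hfin i).toFinset
  let I := J × ℕ
  -- Any linear order serves: it only orders the exponents lexicographically.
  let : LinearOrder I := linearOrderOfSTO WellOrderingRel
  let k := AlgebraicClosure K
  let F := HahnSeries (Lex (I →₀ ℚ)) k
  have hΓ : ∀ (γ : Lex (I →₀ ℚ)) (n : ℕ), n ≠ 0 → ∃ δ : Lex (I →₀ ℚ), n • δ = γ := by
    intro γ n hn
    refine ⟨toLex ((n : ℚ)⁻¹ • ofLex γ), ofLex.injective ?_⟩
    change n • ((n : ℚ)⁻¹ • ofLex γ) = ofLex γ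
    rw [← Nat.cast_smul_eq_nsmul ℚ, smul_smul,
      mul_inv_cancel₀ (Nat.cast_ne_zero.2 hn), one_smul]
  have hF : IsAlgClosed F := HahnSeries.isAlgClosed hΓ
  let t : I → F := fun i => HahnSeries.single (monomialExponent I (Finsupp.single i 1)) 1
  let y : J → F := fun j =>
    ∑ m ∈ Finset.range (s (r j)).card, HahnSeries.C ((θ j : k)) ^ m * t (r j, m)
  have hgen : Function.Injective (MvPolynomial.eval₂Hom (HahnSeries.C : k →+* F) y) :=
    eval₂Hom_vandermonde_injective (HahnSeries.C : k →+* F) t (eval₂Hom_single_injective I k)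
      (fun j => (θ j : k)) r s (fun j => by simp [s]) (fun j i hi i' hi' h => by
        have hi : r i = r j := by simpa [s] using hi
        have hi' : r i' = r j := by simpa [s] using hi'
        exact hinj _ _ (hi.trans hi'.symm) (Subtype.ext h))
  have : CharP k p := charP_of_injective_algebraMap (algebraMap K k).injective p
  let φ₀ : ZMod p →+* k := ZMod.castHom dvd_rfl k
  have hφ₀ : Function.Injective φ₀ := ZMod.castHom_injective k
  refine ⟨F, inferInstance, hF, HahnSeries.mapEndHom.comp ρ,
    (HahnSeries.C : k →+* F).comp φ₀, y, ?_, ?_, ?_⟩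
  · intro c
    have e : {g | (HahnSeries.mapEndHom.comp ρ) g c = c} =
        ⋂ γ, {g | ρ g (c.coeff γ) = c.coeff γ} := by
      ext g
      simp only [Set.mem_ofPred_eq, Set.mem_iInter]
      constructor
      · intro h γ
        conv_rhs => rw [← h]
        rfl
      · intro h
        ext γ
        exact h γ
    rw [e]
    exact isClosed_iInter fun γ => hcl _
  · intro g j
    change HahnSeries.mapEndHom (ρ g) (y j) = y (g • j)
    simp only [y, map_sum, map_mul, map_pow, hrg]
    refine Finset.sum_congr rfl fun m _ => ?_
    have h1 : HahnSeries.mapEndHom (ρ g) (HahnSeries.C (θ j : k)) =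
        (HahnSeries.C (θ (g • j) : k) : F) := by
      have h3 : ((θ (g • j) : SeparableClosure K) : k) = ρ g (θ j) := by rw [hρ, hθ]
      rw [h3]
      exact HahnSeries.mapEndHom_single _ _ _
    have h2 : HahnSeries.mapEndHom (ρ g) (t (r j, m)) = t (r j, m) := by
      simp only [t]
      rw [HahnSeries.mapEndHom_single, map_one]
    rw [h1, h2]
  · have e : MvPolynomial.eval₂Hom ((HahnSeries.C : k →+* F).comp φ₀) y =
        (MvPolynomial.eval₂Hom (HahnSeries.C : k →+* F) y).comp (MvPolynomial.map φ₀) := by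
      refine MvPolynomial.ringHom_ext (fun c => by simp) (fun j => by simp)
    rw [e]
    exact hgen.comp (MvPolynomial.map_injective _ hφ₀)

end AbsGalois

/-! ### Actions on overfields and Galois groups -/

section Galois

variable {F N : Type*} [Field F] [Field N] [Algebra F N]

/-- A semilinear action on an overfield that fixes the base field restricts to a homomorphism
into the Galois group. -/
theorem exists_restriction_to_gal [Normal F N] {C G : Type*} [Field C] [Group G] (j : N →+* C)
    (ρ : G →* (C →+* C))
    (hρ : ∀ g (x : F), ρ g (j (algebraMap F N x)) = j (algebraMap F N x)) :
    ∃ τ : G →* Gal(N/F), ∀ g x, j (τ g x) = ρ g (j x) := by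
  let _ : Algebra N C := j.toAlgebra
  let _ : Algebra F C := (j.comp (algebraMap F N)).toAlgebra
  have : IsScalarTower F N C := IsScalarTower.of_algebraMap_eq fun _ => rfl
  let f : G → (N →ₐ[F] N) := fun g =>
    ({ ρ g with commutes' := hρ g } : C →ₐ[F] C).restrictNormal N
  have hf : ∀ g x, j (f g x) = ρ g (j x) := fun g x => AlgHom.restrictNormal_commutes _ N x
  have hmul : ∀ g h, f (g * h) = (f g).comp (f h) := fun g h => by
    ext x
    apply j.injective
    rw [hf, map_mul, AlgHom.comp_apply, hf, hf]
    rfl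
  have hone : f 1 = AlgHom.id F N := by
    ext x
    apply j.injective
    rw [hf, map_one]
    rfl
  exact ⟨{ toFun g := AlgEquiv.ofAlgHom (f g) (f g⁻¹)
              (by rw [← hmul, mul_inv_cancel, hone]) (by rw [← hmul, inv_mul_cancel, hone])
           map_one' := by ext x; exact DFunLike.congr_fun hone x
           map_mul' g h := by ext x; exact DFunLike.congr_fun (hmul g h) x }, hf⟩

theorem continuous_to_gal_of_isOpen {G : Type*} [Group G] [TopologicalSpace G]
    [IsTopologicalGroup G] (τ : G →* Gal(N/F)) (hτ : ∀ x, IsOpen {g | τ g x = x}) :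
    Continuous τ := by
  refine continuous_of_continuousAt_one τ ?_
  rw [ContinuousAt, map_one]
  intro s hs
  change τ ⁻¹' s ∈ nhds 1
  obtain ⟨E, hE, hs⟩ := (krullTopology_mem_nhds_one_iff F N s).1 hs
  let b := Module.finBasis F E
  have h1 : (⋂ i, {g | τ g (b i) = b i}) ∈ nhds (1 : G) :=
    (isOpen_iInter_of_finite fun i => hτ (b i)).mem_nhds (Set.mem_iInter.2 fun i => by simp)
  refine Filter.mem_of_superset h1 fun g hg => hs ?_
  have hg : ∀ i, τ g (b i) = b i := fun i => Set.mem_iInter.1 hg i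
  have h2 : ((τ g : N →ₐ[F] N).comp E.val).toLinearMap = E.val.toLinearMap := b.ext hg
  intro x
  exact DFunLike.congr_fun h2 x

/-- The orbit of `x` consists of roots of its minimal polynomial, so the stabilizer has finite
index; closed of finite index means open. -/
theorem isOpen_fixed_of_isClosed [Algebra.IsAlgebraic F N] {G : Type*} [Group G]
    [TopologicalSpace G] [IsTopologicalGroup G] (τ : G →* Gal(N/F)) {x : N}
    (hx : IsClosed {g | τ g x = x}) : IsOpen {g | τ g x = x} := by
  let _ : MulAction G N := MulAction.compHom N τ
  let H := MulAction.stabilizer G x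
  have hfin : (MulAction.orbit G x).Finite := by
    refine ((minpoly F x).rootSet_finite N).subset ?_
    rintro _ ⟨g, rfl⟩
    rw [Polynomial.mem_rootSet]
    refine ⟨minpoly.ne_zero (Algebra.IsIntegral.isIntegral x), ?_⟩
    change Polynomial.aeval ((τ g : N →ₐ[F] N) x) (minpoly F x) = 0
    rw [Polynomial.aeval_algHom_apply, minpoly.aeval, map_zero]
  have := hfin.to_subtype
  have : Finite (G ⧸ H) := Finite.of_equiv _ (MulAction.orbitEquivQuotientStabilizer G x)
  have : H.FiniteIndex := Subgroup.finiteIndex_of_finite_quotient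
  exact Subgroup.isOpen_of_isClosed_of_finiteIndex H hx

theorem exists_perm_hom_of_gal {m : ℕ} (X : Fin m → N) (hX : Function.Injective X)
    (h : ∀ (σ : Gal(N/F)) j, ∃ j', σ (X j) = X j') :
    ∃ ψ : Gal(N/F) →* Equiv.Perm (Fin m), ∀ σ j, σ (X j) = X (ψ σ j) := by
  choose f hf using h
  have hmul : ∀ σ σ' j, f (σ * σ') j = f σ (f σ' j) := fun σ σ' j =>
    hX (by rw [← hf, ← hf, ← hf, AlgEquiv.mul_apply])
  have hone : ∀ j, f 1 j = j := fun j => hX (by rw [← hf, AlgEquiv.one_apply])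
  exact ⟨{ toFun σ := ⟨f σ, f σ⁻¹, fun j => by rw [← hmul, inv_mul_cancel, hone],
              fun j => by rw [← hmul, mul_inv_cancel, hone]⟩
           map_one' := Equiv.ext hone
           map_mul' σ σ' := Equiv.ext (hmul σ σ') }, hf⟩

/-- If a family is permuted by `ρ`, then the coefficients of `∏ (X - xⱼ)` are fixed. -/
theorem fixed_coeff_prod_X_sub_C {C : Type*} [Field C] (j : N →+* C) (ρ : C →+* C) {m : ℕ}
    (X : Fin m → N) (π : Equiv.Perm (Fin m)) (h : ∀ i, ρ (j (X i)) = j (X (π i))) (n : ℕ) :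
    ρ (j ((∏ i, (Polynomial.X - Polynomial.C (X i))).coeff n)) =
      j ((∏ i, (Polynomial.X - Polynomial.C (X i))).coeff n) := by
  rw [← RingHom.comp_apply, ← Polynomial.coeff_map, ← Polynomial.coeff_map]
  congr 1
  rw [Polynomial.map_prod, Polynomial.map_prod]
  simp only [Polynomial.map_sub, Polynomial.map_X, Polynomial.map_C, RingHom.comp_apply, h]
  exact Equiv.prod_comp π fun i => Polynomial.X - Polynomial.C (j (X i))

theorem exists_gal_apply_eq_of_coeff_mem {m : ℕ} (X : Fin m → N)
    (hc : ∀ n, ∃ c : F, algebraMap F N c =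
      (∏ i, (Polynomial.X - Polynomial.C (X i))).coeff n) (σ : Gal(N/F)) (j : Fin m) :
    ∃ j', σ (X j) = X j' := by
  set Q := ∏ i, (Polynomial.X - Polynomial.C (X i)) with hQ
  have h1 : Q.map (σ : N →+* N) = Q := by
    ext n
    obtain ⟨c, hc⟩ := hc n
    rw [Polynomial.coeff_map, ← hc]
    exact σ.commutes c
  have h2 : Q.eval (σ (X j)) = 0 := by
    rw [← h1]
    have h3 : Q.eval (X j) = 0 := by
      rw [hQ, Polynomial.eval_prod]
      exact Finset.prod_eq_zero (Finset.mem_univ j) (by simp)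
    change Polynomial.eval ((σ : N →+* N) (X j)) _ = 0
    rw [Polynomial.eval_map_apply, h3, map_zero]
  rw [hQ, Polynomial.eval_prod, Finset.prod_eq_zero_iff] at h2
  obtain ⟨j', -, hj'⟩ := h2
  exact ⟨j', by simpa [sub_eq_zero] using hj'⟩

theorem isSeparable_of_coeff_mem {m : ℕ} (X : Fin m → N) (hX : Function.Injective X)
    (hc : ∀ n, ∃ c : F, algebraMap F N c =
      (∏ i, (Polynomial.X - Polynomial.C (X i))).coeff n) (j : Fin m) :
    IsSeparable F (X j) := by
  have hl : ∏ i, (Polynomial.X - Polynomial.C (X i)) ∈ Polynomial.lifts (algebraMap F N) :=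
    (Polynomial.lifts_iff_coeff_lifts _).2 hc
  obtain ⟨Q, hQ⟩ := Polynomial.mem_lifts _ |>.1 hl
  have hsep : Q.Separable := by
    rw [← Polynomial.separable_map (algebraMap F N), hQ]
    exact Polynomial.separable_prod_X_sub_C_iff.2 hX
  refine hsep.of_dvd (minpoly.dvd F _ ?_)
  rw [Polynomial.aeval_def, ← Polynomial.eval_map, hQ, Polynomial.eval_prod]
  exact Finset.prod_eq_zero (Finset.mem_univ j) (by simp)

end Galois

/-! ### The field solving all permutation problems -/

section Construction

variable {ι : Type} {A : ι → Type u} [∀ i, Group (A i)] [∀ i, TopologicalSpace (A i)]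
  [∀ i, IsTopologicalGroup (A i)] {D : Type u} {m : D → ℕ}

/-- The conclusion of the construction: a field of characteristic `p` whose absolute Galois group
is topologically generated by images of the groups `A i`, such that every prescribed family of
permutation representations of the `A i` extends to it. -/
def HasGaloisRealization (p : ℕ) (η : ∀ i, ∀ d, A i →* Equiv.Perm (Fin (m d))) : Prop :=
  ∃ (F : Type u) (_ : Field F), CharP F p ∧ ∃ τ : ∀ i, A i →* AbsGaloisGroup F,
    (∀ i, Continuous (τ i)) ∧ (⨆ i, (τ i).range).topologicalClosure = ⊤ ∧
    ∀ d, ∃ ψ : AbsGaloisGroup F →* Equiv.Perm (Fin (m d)),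
      IsOpen (ψ.ker : Set (AbsGaloisGroup F)) ∧ ∀ i g, ψ (τ i g) = η i d g

/-- The field sought is the subfield `F` of `N` fixed by all groups through the embeddings `j i`.
The base `M` guarantees that `N` is a separable closure of `F`; normality then makes each group act
on `N`. -/
theorem hasGaloisRealization_of_embeddings (p : ℕ)
    (η : ∀ i, ∀ d, A i →* Equiv.Perm (Fin (m d)))
    {M N : Type u} [Field M] [Field N] [Algebra M N] [IsSepClosure M N] [CharP N p]
    (C : ι → Type u) [∀ i, Field (C i)] (ρ : ∀ i, A i →* (C i →+* C i))
    (hcl : ∀ i c, IsClosed {g | ρ i g c = c}) (j : ∀ i, N →+* C i)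
    (hM : ∀ i g (x : M), ρ i g (j i (algebraMap M N x)) = j i (algebraMap M N x))
    (X : ∀ d, Fin (m d) → N) (hX : ∀ d, Function.Injective (X d))
    (hρ : ∀ i g d k, ρ i g (j i (X d k)) = j i (X d (η i d g k))) :
    HasGaloisRealization p η := by
  let F : IntermediateField M N :=
    { carrier := {x | ∀ i g, ρ i g (j i x) = j i x}
      mul_mem' := fun {x y} hx hy i g => by rw [map_mul, map_mul, hx i g, hy i g]
      add_mem' := fun {x y} hx hy i g => by rw [map_add, map_add, hx i g, hy i g]
      inv_mem' := fun x hx i g => by rw [map_inv₀, map_inv₀, hx i g]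
      algebraMap_mem' := fun x i g => hM i g x }
  have hF : ∀ x : N, x ∈ F ↔ ∀ i g, ρ i g (j i x) = j i x := fun x => Iff.rfl
  have : IsSepClosed N := IsSepClosure.sep_closed M
  have : Algebra.IsSeparable M N := IsSepClosure.separable
  have : IsSepClosure F N := ⟨inferInstance, inferInstance⟩
  let N' := SeparableClosure F
  let e : N ≃ₐ[F] N' := IsSepClosure.equiv F N N'
  let j' : ∀ i, N' →+* C i := fun i => (j i).comp (e.symm : N' →+* N)
  have hj' : ∀ i x, j' i (e x) = j i x := fun i x => congrArg (j i) (e.symm_apply_apply x)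
  have hfix : ∀ i g (x : F), ρ i g (j' i (algebraMap F N' x)) = j' i (algebraMap F N' x) := by
    intro i g x
    have h : j' i (algebraMap F N' x) = j i x := congrArg (j i) (e.symm.commutes x)
    rw [h]
    exact x.2 i g
  have hfix' : ∀ x : N', (∀ i g, ρ i g (j' i x) = j' i x) → ∃ c : F, algebraMap F N' c = x := by
    intro x hx
    refine ⟨⟨e.symm x, hx⟩, ?_⟩
    rw [← e.commutes]
    exact e.apply_symm_apply x
  choose τ hτ using fun i => exists_restriction_to_gal (F := F) (j' i) (ρ i) (hfix i)
  have hopen : ∀ i x, IsOpen {g | τ i g x = x} := by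
    intro i x
    apply isOpen_fixed_of_isClosed
    convert hcl i (j' i x) using 1
    ext g
    simp only [Set.mem_ofPred_eq]
    rw [← hτ, (j' i).injective.eq_iff]
  let X' : ∀ d, Fin (m d) → N' := fun d k => e (X d k)
  have hX' : ∀ d, Function.Injective (X' d) := fun d => e.injective.comp (hX d)
  have hρ' : ∀ i g d k, ρ i g (j' i (X' d k)) = j' i (X' d (η i d g k)) := by
    intro i g d k
    rw [hj', hj', hρ]
  refine ⟨F, inferInstance, (RingHom.charP_iff_charP (algebraMap F N) p).2 inferInstance, τ,
    fun i => continuous_to_gal_of_isOpen _ (hopen i), ?_, fun d => ?_⟩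
  -- The closed subgroup generated by the images fixes only `F`, so it is the whole Galois group.
  · let H : ClosedSubgroup (AbsGaloisGroup F) :=
      ⟨(⨆ i, (τ i).range).topologicalClosure, Subgroup.isClosed_topologicalClosure _⟩
    have h1 := InfiniteGalois.fixingSubgroup_fixedField H
    have h2 : IntermediateField.fixedField (H : Subgroup (AbsGaloisGroup F)) = ⊥ := by
      rw [eq_bot_iff]
      intro x hx
      obtain ⟨c, hc⟩ := hfix' x fun i g => by
        rw [← hτ]
        congr 1
        exact hx ⟨τ i g, Subgroup.le_topologicalClosure _
          (Subgroup.mem_iSup_of_mem i ⟨g, rfl⟩)⟩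
      exact IntermediateField.mem_bot.2 ⟨c, hc⟩
    rw [h2, IntermediateField.fixingSubgroup_bot] at h1
    exact h1.symm
  · obtain ⟨ψ, hψ⟩ := exists_perm_hom_of_gal (F := F) (X' d) (hX' d)
      (exists_gal_apply_eq_of_coeff_mem (X' d) fun n => hfix' _ fun i g =>
        fixed_coeff_prod_X_sub_C (j' i) (ρ i g) (X' d) (η i d g) (hρ' i g d) n)
    refine ⟨ψ, ?_, fun i g => Equiv.ext fun k => hX' d ((j' i).injective ?_)⟩
    · have h : (ψ.ker : Set (AbsGaloisGroup F)) =
          ⋂ k, (MulAction.stabilizer (AbsGaloisGroup F) (X' d k) : Set (AbsGaloisGroup F)) := by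
        ext σ
        simp only [SetLike.mem_coe, MonoidHom.mem_ker, Set.mem_iInter,
          MulAction.mem_stabilizer_iff, AlgEquiv.smul_def, hψ]
        constructor
        · intro h k
          rw [h]
          rfl
        · exact fun h => Equiv.ext fun k => hX' d (h k)
      rw [h]
      exact isOpen_iInter_of_finite fun k => stabilizer_isOpen_of_isIntegral _
    · rw [← hψ, hτ, hρ']

/-- Each embedding of `L` extends to its separable closure because the target is algebraically
closed. -/
theorem hasGaloisRealization_of_separable (p : ℕ)
    (η : ∀ i, ∀ d, A i →* Equiv.Perm (Fin (m d)))
    {M L : Type u} [Field M] [Field L] [Algebra M L] [Algebra.IsSeparable M L] [CharP L p]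
    (C : ι → Type u) [∀ i, Field (C i)] [∀ i, IsAlgClosed (C i)]
    (ρ : ∀ i, A i →* (C i →+* C i)) (hcl : ∀ i c, IsClosed {g | ρ i g c = c})
    (f : ∀ i, L →+* C i)
    (hM : ∀ i g (x : M), ρ i g (f i (algebraMap M L x)) = f i (algebraMap M L x))
    (X : ∀ d, Fin (m d) → L) (hX : ∀ d, Function.Injective (X d))
    (hρ : ∀ i g d k, ρ i g (f i (X d k)) = f i (X d (η i d g k))) :
    HasGaloisRealization p η := by
  let N := SeparableClosure L
  let _ : Algebra M N := ((algebraMap L N).comp (algebraMap M L)).toAlgebra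
  have : IsScalarTower M L N := IsScalarTower.of_algebraMap_eq fun _ => rfl
  have : IsSepClosure M N := ⟨inferInstance, Algebra.IsSeparable.trans M L N⟩
  have : CharP N p := charP_of_injective_algebraMap (algebraMap L N).injective p
  have hlift : ∀ i, ∃ j : N →+* C i, ∀ z, j (algebraMap L N z) = f i z := by
    intro i
    let _ : Algebra L (C i) := (f i).toAlgebra
    let j : N →ₐ[L] C i := IsAlgClosed.lift
    exact ⟨j, fun z => j.commutes z⟩
  choose j hj using hlift
  refine hasGaloisRealization_of_embeddings (M := M) (N := N) p η C ρ hcl j (fun i g z => ?_)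
    (fun d k => algebraMap L N (X d k))
    (fun d => (algebraMap L N).injective.comp (hX d)) (fun i g d k => ?_)
  · have h : j i (algebraMap M N z) = f i (algebraMap M L z) := hj i _
    rw [h]
    exact hM i g z
  · rw [hj, hj, hρ]

/-- The rational function field `L` in all points of all problems embeds in every model. It is
separable over its fixed subfield `M`, since the variables of one problem are the distinct roots of
a polynomial over `M`. -/
theorem hasGaloisRealization_of_models (p : ℕ) (hp : p = 0 ∨ p.Prime)
    (η : ∀ i, ∀ d, A i →* Equiv.Perm (Fin (m d)))
    (hmod : ∀ i, HasGenericModel p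
      ((Equiv.Perm.sigmaCongrRightHom fun d => Fin (m d)).comp (MonoidHom.pi (η i)))) :
    HasGaloisRealization p η := by
  choose C instC hC ρ φ y hcl hy hinj using hmod
  let J := Σ d, Fin (m d)
  have : IsDomain (ZMod p) := by
    rcases hp with rfl | hp
    · exact inferInstanceAs (IsDomain ℤ)
    · have : Fact p.Prime := ⟨hp⟩
      infer_instance
  let R := MvPolynomial J (ZMod p)
  let L := FractionRing R
  let x : J → L := fun q => algebraMap R L (MvPolynomial.X q)
  have hx : Function.Injective x :=
    (IsFractionRing.injective R L).comp (MvPolynomial.X_injective (R := ZMod p))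
  let f : ∀ i, L →+* C i := fun i => IsFractionRing.lift (hinj i)
  have hf : ∀ i (r : R), f i (algebraMap R L r) = MvPolynomial.eval₂Hom (φ i) (y i) r :=
    fun i r => IsFractionRing.lift_algebraMap (hinj i) r
  have hfx : ∀ i q, f i (x q) = y i q := fun i q => by rw [hf]; simp
  have hρf : ∀ i g d k, ρ i g (f i (x ⟨d, k⟩)) = f i (x ⟨d, η i d g k⟩) := by
    intro i g d k
    rw [hfx, hfx, hy]
    rfl
  let M : Subfield L :=
    { carrier := {x | ∀ i g, ρ i g (f i x) = f i x}
      mul_mem' := fun {x y} hx hy i g => by rw [map_mul, map_mul, hx i g, hy i g]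
      add_mem' := fun {x y} hx hy i g => by rw [map_add, map_add, hx i g, hy i g]
      neg_mem' := fun {x} hx i g => by rw [map_neg, map_neg, hx i g]
      one_mem' := fun i g => by rw [map_one, map_one]
      zero_mem' := fun i g => by rw [map_zero, map_zero]
      inv_mem' := fun x hx i g => by rw [map_inv₀, map_inv₀, hx i g] }
  have hsepx : ∀ q, IsSeparable M (x q) := by
    rintro ⟨d, k⟩
    exact isSeparable_of_coeff_mem (F := M) (fun k => x ⟨d, k⟩)
      (hx.comp sigma_mk_injective) (fun n => ⟨⟨_, fun i g =>
        fixed_coeff_prod_X_sub_C (f i) (ρ i g) (fun k => x ⟨d, k⟩) (η i d g) (hρf i g d) n⟩,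
        rfl⟩) k
  have hsepR : ∀ r : R, algebraMap R L r ∈ separableClosure M L := by
    intro r
    induction r using MvPolynomial.induction_on with
    | C c =>
      refine (separableClosure M L).algebraMap_mem ⟨_, fun i g => ?_⟩
      -- Homomorphisms out of `ZMod p` are unique, so constants are fixed.
      have h : (ρ i g).comp ((f i).comp ((algebraMap R L).comp MvPolynomial.C)) =
          (f i).comp ((algebraMap R L).comp MvPolynomial.C) := Subsingleton.elim _ _
      exact DFunLike.congr_fun h c
    | add r s hr hs => rw [map_add]; exact add_mem hr hs
    | mul_X r q hr => rw [map_mul]; exact mul_mem hr (hsepx q)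
  have : Algebra.IsSeparable M L := ⟨fun z => by
    obtain ⟨r, s, -, rfl⟩ := IsFractionRing.div_surjective (A := R) z
    exact div_mem (hsepR r) (hsepR s)⟩
  have : CharP L p := charP_of_injective_algebraMap (IsFractionRing.injective R L) p
  exact hasGaloisRealization_of_separable (M := M) p η C ρ hcl f (fun i g z => z.2 i g)
    (fun d k => x ⟨d, k⟩) (fun d => hx.comp sigma_mk_injective) hρf

end Construction

/-! ### Recognizing free profinite products -/

section FreeProduct

theorem exists_perm_hom_ne_one {G : Type*} [Group G] [TopologicalSpace G] [IsTopologicalGroup G]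
    [CompactSpace G] [TotallyDisconnectedSpace G] {x : G} (hx : x ≠ 1) :
    ∃ (m : ℕ) (π : G →* Equiv.Perm (Fin m)), IsOpen (π.ker : Set G) ∧ π x ≠ 1 := by
  obtain ⟨U, hU⟩ := ProfiniteGrp.exist_openNormalSubgroup_sub_open_nhds_of_one
    (isOpen_compl_singleton (x := x)) hx.symm
  have : Finite (G ⧸ (U : Subgroup G)) := Subgroup.quotient_finite_of_isOpen _ U.isOpen'
  let e := Finite.equivFin (G ⧸ (U : Subgroup G))
  let π : G →* Equiv.Perm (Fin (Nat.card (G ⧸ (U : Subgroup G)))) :=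
    e.permCongrHom.toMonoidHom.comp (MulAction.toPermHom G (G ⧸ (U : Subgroup G)))
  have hker : π.ker = (U : Subgroup G) := by
    refine (MonoidHom.ker_mulEquiv_comp (MulAction.toPermHom G _) e.permCongrHom).trans ?_
    rw [← Subgroup.normalCore_eq_ker, Subgroup.normalCore_eq_self]
  refine ⟨_, π, ?_, fun h => ?_⟩
  · rw [hker]
    exact U.isOpen'
  · have h1 : x ∈ π.ker := h
    rw [hker] at h1
    exact hU h1 rfl

/-- A family of finite permutation representations of the groups `A i` of common degree, with
open kernels. -/
structure PermutationProblem {ι : Type} (A : ι → Type u) [∀ i, Group (A i)]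
    [∀ i, TopologicalSpace (A i)] : Type u where
  degree : ℕ
  hom : ∀ i, A i →* Equiv.Perm (Fin degree)
  isOpen_ker : ∀ i, IsOpen ((hom i).ker : Set (A i))

variable {ι : Type} {A : ι → Type u} [∀ i, Group (A i)] [∀ i, TopologicalSpace (A i)]
  {G : Type u} [Group G] [TopologicalSpace G]

/-- A representation of `A i` nontrivial at `x`, paired with trivial ones of the other groups, is a
problem whose solution shows `τ i x ≠ 1`. -/
theorem injective_of_forall_permutationProblem [∀ i, IsTopologicalGroup (A i)]
    [∀ i, CompactSpace (A i)] [∀ i, TotallyDisconnectedSpace (A i)] (τ : ∀ i, A i →* G)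
    (hτ : ∀ d : PermutationProblem A, ∃ ψ : G →* Equiv.Perm (Fin d.degree),
      IsOpen (ψ.ker : Set G) ∧ ∀ i g, ψ (τ i g) = d.hom i g) (i : ι) :
    Function.Injective (τ i) := by
  classical
  rw [injective_iff_map_eq_one]
  intro x hx
  by_contra hne
  obtain ⟨m, π, hπ, hπx⟩ := exists_perm_hom_ne_one hne
  obtain ⟨ψ, -, hψ⟩ := hτ
    { degree := m
      hom := Function.update (fun _ => 1) i π
      isOpen_ker := fun k => by
        obtain rfl | hk := eq_or_ne k i
        · rwa [Function.update_self]
        · rw [Function.update_of_ne hk, MonoidHom.ker_one]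
          exact isOpen_univ }
  have h := hψ i x
  rw [hx, map_one] at h
  exact hπx (by simpa using h.symm)

/-- The closed subgroup `Γ` of `G × H` generated by the pairs `(τ i g, η i g)` is the graph of the
extension. It surjects onto `G` by generation. It is single valued because a representation `π` of
`H` pulls back to a problem with solution `ψ`, and `Γ` lies in the closed subgroup where `ψ` and `π`
agree. -/
theorem exists_extend_of_forall_permutationProblem [IsTopologicalGroup G] [CompactSpace G]
    [TotallyDisconnectedSpace G] (τ : ∀ i, A i →* G)
    (hgen : (⨆ i, (τ i).range).topologicalClosure = ⊤)
    (hτ : ∀ d : PermutationProblem A, ∃ ψ : G →* Equiv.Perm (Fin d.degree),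
      IsOpen (ψ.ker : Set G) ∧ ∀ i g, ψ (τ i g) = d.hom i g)
    {H : Type*} [Group H] [TopologicalSpace H] [IsTopologicalGroup H] [CompactSpace H]
    [TotallyDisconnectedSpace H] (η : ∀ i, A i →ₜ* H) :
    ∃ φ : G →ₜ* H, ∀ i g, φ (τ i g) = η i g := by
  let Γ : Subgroup (G × H) :=
    (⨆ i, ((τ i).prod (η i : A i →* H)).range).topologicalClosure
  have hmem : ∀ i g, (τ i g, η i g) ∈ Γ := fun i g =>
    Subgroup.le_topologicalClosure _ (Subgroup.mem_iSup_of_mem i ⟨g, rfl⟩)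
  have hΓ : IsClosed (Γ : Set (G × H)) := Subgroup.isClosed_topologicalClosure _
  have : CompactSpace Γ := isCompact_iff_compactSpace.1 hΓ.isCompact
  let q : Γ →* G := (MonoidHom.fst G H).comp Γ.subtype
  have hq : Continuous q := continuous_fst.comp continuous_subtype_val
  have hsurj : Function.Surjective q := by
    rw [← MonoidHom.range_eq_top, eq_top_iff, ← hgen]
    refine Subgroup.topologicalClosure_minimal _ (iSup_le fun i => ?_) ?_
    · rintro _ ⟨g, rfl⟩
      exact ⟨⟨_, hmem i g⟩, rfl⟩
    · rw [MonoidHom.coe_range]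
      exact (isCompact_range hq).isClosed
  have hinj : Function.Injective q := by
    rw [injective_iff_map_eq_one]
    rintro ⟨⟨g, h⟩, hgh⟩ (rfl : g = 1)
    by_contra hne
    obtain ⟨m, π, hπ, hπx⟩ := exists_perm_hom_ne_one (x := h) (by
      rintro rfl
      exact hne rfl)
    obtain ⟨ψ, hψ, hψη⟩ := hτ
      { degree := m
        hom := fun i => π.comp (η i : A i →* H)
        isOpen_ker := fun i => hπ.preimage (η i).continuous }
    let E := (ψ.comp (MonoidHom.fst G H)).eqLocus (π.comp (MonoidHom.snd G H))
    have hE : IsClosed (E : Set (G × H)) := by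
      refine Subgroup.isClosed_of_isOpen _ (Subgroup.isOpen_mono (H₁ := ψ.ker.prod π.ker) ?_ ?_)
      · rintro ⟨a, b⟩ ⟨ha, hb⟩
        exact Eq.trans ha (Eq.symm hb)
      · exact hψ.prod hπ
    have hle : Γ ≤ E := by
      refine Subgroup.topologicalClosure_minimal _ (iSup_le fun i => ?_) hE
      rintro _ ⟨g, rfl⟩
      exact hψη i g
    have h1 : ψ 1 = π h := hle hgh
    exact hπx (by rw [← h1, map_one])
  let e : Γ ≃* G := MulEquiv.ofBijective q ⟨hinj, hsurj⟩
  have he : Continuous e.symm :=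
    (Continuous.homeoOfEquivCompactToT2 (f := e.toEquiv) hq).symm.continuous
  refine ⟨⟨((MonoidHom.snd G H).comp Γ.subtype).comp e.symm.toMonoidHom,
    continuous_snd.comp (continuous_subtype_val.comp he)⟩, fun i g => ?_⟩
  have h1 : e.symm (τ i g) = ⟨_, hmem i g⟩ := by
    rw [MulEquiv.symm_apply_eq]
    rfl
  change (e.symm (τ i g)).1.2 = _
  rw [h1]

theorem ContinuousMonoidHom.ext_of_topologicalClosure_eq_top [IsTopologicalGroup G]
    {S : ι → Subgroup G}
    (hgen : (⨆ i, S i).topologicalClosure = ⊤) {H : Type*} [Group H] [TopologicalSpace H]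
    [T2Space H] {φ φ' : G →ₜ* H} (h : ∀ i, ∀ g ∈ S i, φ g = φ' g) : φ = φ' := by
  have hle : (⊤ : Subgroup G) ≤ (φ : G →* H).eqLocus (φ' : G →* H) := by
    rw [← hgen]
    exact Subgroup.topologicalClosure_minimal _ (iSup_le fun i g hg => h i g hg)
      (isClosed_eq φ.continuous φ'.continuous)
  ext g
  exact hle (Subgroup.mem_top g)

/-- A profinite group topologically generated by images of the profinite groups `A i` is their
free profinite product as soon as all finite permutation representations extend. -/
theorem isIsoFreeProfiniteProduct_of_forall_permutationProblem [Finite ι]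
    [IsTopologicalGroup G] [CompactSpace G] [TotallyDisconnectedSpace G]
    [∀ i, IsTopologicalGroup (A i)] [∀ i, CompactSpace (A i)]
    [∀ i, TotallyDisconnectedSpace (A i)] (τ : ∀ i, A i →* G)
    (hcont : ∀ i, Continuous (τ i)) (hgen : (⨆ i, (τ i).range).topologicalClosure = ⊤)
    (hτ : ∀ d : PermutationProblem A, ∃ ψ : G →* Equiv.Perm (Fin d.degree),
      IsOpen (ψ.ker : Set G) ∧ ∀ i g, ψ (τ i g) = d.hom i g) :
    IsIsoFreeProfiniteProduct G A := by
  have hinj := injective_of_forall_permutationProblem τ hτ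
  refine ⟨fun i => (τ i).range, ⟨fun i => ?_, hgen, fun H η => ?_⟩, fun i => ⟨?_⟩⟩
  · rw [MonoidHom.coe_range]
    exact (isCompact_range (hcont i)).isClosed
  · obtain ⟨φ, hφ⟩ := exists_extend_of_forall_permutationProblem τ hgen hτ
      fun i => (η i).comp ⟨(τ i).rangeRestrict, (hcont i).subtype_mk _⟩
    refine ⟨φ, ?_, fun φ' hφ' => ?_⟩
    · rintro i ⟨_, g, rfl⟩
      exact hφ i g
    · refine ContinuousMonoidHom.ext_of_topologicalClosure_eq_top hgen ?_
      rintro i _ ⟨g, rfl⟩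
      exact (hφ' i ⟨_, g, rfl⟩).trans (hφ i g).symm
  · let e := (τ i).ofInjective (hinj i)
    have he : Continuous e := (hcont i).subtype_mk _
    exact { e with
      continuous_toFun := he
      continuous_invFun :=
        (Continuous.homeoOfEquivCompactToT2 (f := e.toEquiv) he).symm.continuous }

end FreeProduct

/-! ### Assembly of the theorem -/

theorem exists_absGaloisGroup_isIsoFreeProfiniteProduct {ι : Type} [Finite ι] {A : ι → Type u}
    [∀ i, Group (A i)] [∀ i, TopologicalSpace (A i)] [∀ i, IsTopologicalGroup (A i)]
    [∀ i, CompactSpace (A i)] [∀ i, TotallyDisconnectedSpace (A i)] (p : ℕ)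
    (hp : p = 0 ∨ p.Prime)
    (hA : ∀ i (J : Type u) (a : A i →* Equiv.Perm J), (∀ j, IsOpen {g | a g j = j}) →
      HasGenericModel p a) :
    ∃ (F : Type u) (_ : Field F), CharP F p ∧ IsIsoFreeProfiniteProduct (AbsGaloisGroup F) A := by
  obtain ⟨F, hF, hchar, τ, hcont, hgen, hτ⟩ := hasGaloisRealization_of_models p hp
    (fun i (d : PermutationProblem A) => d.hom i) fun i => hA i _ _ fun ⟨d, k⟩ => by
      -- The stabilizer of a point of problem `d` contains the open kernel of the representation in
      -- `d`.
      refine Subgroup.isOpen_mono (H₁ := (d.hom i).ker) (H₂ := (MulAction.stabilizer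
        (Equiv.Perm (Σ d : PermutationProblem A, Fin d.degree)) (⟨d, k⟩ : Σ d, Fin _)).comap
          ((Equiv.Perm.sigmaCongrRightHom fun d : PermutationProblem A => Fin d.degree).comp
            (MonoidHom.pi fun d => d.hom i))) (fun g hg => ?_) (d.isOpen_ker i)
      change (⟨d, d.hom i g k⟩ : Σ d : PermutationProblem A, Fin d.degree) = ⟨d, k⟩
      rw [MonoidHom.mem_ker.1 hg, Equiv.Perm.one_apply]
  exact ⟨F, hF, hchar, isIsoFreeProfiniteProduct_of_forall_permutationProblem τ hcont hgen hτ⟩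

theorem theorem3p4 (n : ℕ) (K : Fin n → Type u) [∀ i, Field (K i)] :
    (∃ (F : Type u) (_ : Field F), CharZero F ∧
      IsIsoFreeProfiniteProduct (AbsGaloisGroup F) (fun i => AbsGaloisGroup (K i))) ∧
    (∀ p : ℕ, (p = 0 ∨ p.Prime) → (∀ i, CharP (K i) p) →
      ∃ (F : Type u) (_ : Field F), CharP F p ∧
        IsIsoFreeProfiniteProduct (AbsGaloisGroup F) (fun i => AbsGaloisGroup (K i))) := by
  constructor
  · obtain ⟨F, hF, hchar, h⟩ := exists_absGaloisGroup_isIsoFreeProfiniteProduct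
      (A := fun i => AbsGaloisGroup (K i)) 0 (Or.inl rfl) fun i J a ha => by
        -- The characteristics may differ; each positive one is lifted to 0 separately, at the level
        -- of models.
        obtain ⟨q, hq⟩ := CharP.exists (K i)
        obtain hq' | rfl := CharP.char_is_prime_or_zero (K i) q
        · exact (hasGenericModel_of_charP (K i) q a ha).charZero hq'
        · exact hasGenericModel_of_charP (K i) 0 a ha
    exact ⟨F, hF, CharP.charP_to_charZero F, h⟩
  · intro p hp hchar
    exact exists_absGaloisGroup_isIsoFreeProfiniteProduct p hp fun i J a ha =>
      hasGenericModel_of_charP (K i) p a ha
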